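/- Let $p\ge 2$ and $k>0$. Let $\mathrm{Sym}^+(p)$ be the set of symmetric positive definite real $p\times p$ matrices, $\mathrm{Diag}^+(p)$ the set of diagonal matrices with positive diagonal entries, $M(p)=SO(p)\times \mathrm{Diag}^+(p)$, and $F:M(p)\to \mathrm{Sym}^+(p)$, $F(U,D)=UDU^T$, with fibers $\mathcal E_X=F^{-1}(X)$. Give $SO(p)$ the bi-invariant Riemannian metric $g_{SO}$ with $g_{SO}|_I(A_1,A_2)=-\tfrac12\mathrm{tr}(A_1A_2)$ and geodesic distance $d_{SO}$, give $\mathrm{Diag}^+(p)$ the metric $g_{\mathcal D}|_D(L_1,L_2)=\mathrm{tr}(D^{-1}L_1D^{-1}L_2)$, and give $M(p)$ the metric $k\,g_{SO}\oplus g_{\mathcal D}$ with length $\ell$ and geodesic distance $d_M$. For $X,Y\in \mathrm{Sym}^+(p)$ put $$d_{\mathcal{SR}}(X,Y)=\inf\{d_M(q_0,q_1): q_0\in\mathcal E_X,\ q_1\in\mathcal E_Y\}.$$ An $F$-minimal geodesic from $\mathcal E_X$ to $\mathcal E_Y$ is a piecewise smooth curve $\gamma:[0,1]\to M(p)$ with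 $\gamma(0)\in\mathcal E_X$, $\gamma(1)\in\mathcal E_Y$ and $\ell(\gamma)=d_{\mathcal{SR}}(X,Y)$; its pair of endpoints is called a minimal pair, the curve $\chi=F\circ\gamma$ is called a minimal smooth scaling-rotation (MSSR) curve from $X$ to $Y$, and $\chi$ is said to correspond to the minimal pair $(\gamma(0),\gamma(1))$. Let $\tilde S_p^+\subset SO(p)$ be the group of even signed permutations, i.e. of the matrices $P_g\in SO(p)$ with all entries in $\{0,1,-1\}$; each $g\in\tilde S_p^+$ has an underlying permutation $\pi_g\in S_p$ (with $P_ge_i=\pm e_{\pi_g(i)}$), and $S_p$ acts on diagonal matrices by permuting the diagonal entries, so that $\pi_g\cdot D=P_gDP_g^{-1}$. For $D\in\mathrm{Diag}^+(p)$ let $G_D^0$ be the identity component of $G_D=\{R\in SO(p): RDR^T=D\}$ and let $\Gamma^0_{D}=\tilde S_p^+\cap G_D^0$. For $(U,D)\in\mathcal E_X$ let $[(U,D)]=\{(UR,D):R\in G_D^0\}$, the connected component of $\mathcal E_X$ containing $(U,D)$. Let $\|\cdot\|$ be the Frobenius norm. Let $X,Y\in\mathrm{Sym}^+(p)$, $(U,D)\in\mathcal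 E_X$, $(V,\Lambda)\in\mathcal E_Y$, and let $Z\subset\tilde S_p^+$ be any set containing exactly one element of each double coset in $\Gamma^0_D\backslash\tilde S_p^+/\Gamma^0_\Lambda$. Then $$d_{\mathcal{SR}}(X,Y)^2=\min_{g\in Z}\Big\{k\,\hat d(g)^2+\big\|\log\big(D^{-1}(\pi_g\cdot\Lambda)\big)\big\|^2\Big\},\qquad \hat d(g)=\min_{R_U\in G_D^0,\ R_V\in G_\Lambda^0} d_{SO}\big(UR_U,\,VR_VP_g^{-1}\big),$$ where all the minima are attained. Moreover, every MSSR curve from $X$ to $Y$ corresponds to some minimal pair whose first element lies in $[(U,D)]$; and every $F$-minimal geodesic $\gamma$ parametrized proportionally to arc length has the same projection $F\circ\gamma=F\circ\gamma'$ as some $F$-minimal geodesic $\gamma'$ parametrized proportionally to arc length with $\gamma'(0)\in[(U,D)]$. -/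

import Mathlib

open Set
open scoped ContDiff Matrix

namespace ScalingRotation

noncomputable section

/-! ### The spaces -/

/-- The Lie group `SO(p)` of special orthogonal real `p × p` matrices. -/
abbrev SO (p : ℕ) : Type := ↥(Matrix.specialOrthogonalGroup (Fin p) ℝ)

/-- `Diag⁺(p)`: diagonal matrices with positive diagonal entries. -/
def DiagPos (p : ℕ) : Type :=
  {D : Matrix (Fin p) (Fin p) ℝ // D.IsDiag ∧ ∀ i, 0 < D i i}

/-- `Sym⁺(p)`: symmetric positive definite matrices. -/
def SymPos (p : ℕ) : Type := {X : Matrix (Fin p) (Fin p) ℝ // X.PosDef}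

/-- `M(p) = SO(p) × Diag⁺(p)`. -/
abbrev M (p : ℕ) : Type := SO p × DiagPos p

theorem eigenComposition_posDef {p : ℕ} (U : SO p) (D : DiagPos p) :
    (U.1 * D.1 * U.1ᵀ).PosDef := by
  have hD : (D.1).PosDef := by
    rw [← D.2.1.diagonal_diag]
    exact Matrix.PosDef.diagonal (fun i => D.2.2 i)
  have hU : U.1ᵀ * U.1 = 1 :=
    (Matrix.mem_orthogonalGroup_iff' (Fin p) ℝ).1
      (Matrix.mem_specialOrthogonalGroup_iff.1 U.2).1
  have h := hD.mul_mul_conjTranspose_same (B := U.1) (by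
    intro x y hxy
    have h2 := congrArg (fun v => Matrix.vecMul v U.1ᵀ) hxy
    have hU' : U.1 * U.1ᵀ = 1 := mul_eq_one_comm.1 hU
    simpa [Matrix.vecMul_vecMul, hU'] using h2)
  simpa [Matrix.conjTranspose_eq_transpose_of_trivial] using h

/-- The eigen-composition map `F : M(p) → Sym⁺(p)`, `F(U, D) = U D Uᵀ`. -/
def F {p : ℕ} (q : M p) : SymPos p :=
  ⟨q.1.1 * q.2.1 * q.1.1ᵀ, eigenComposition_posDef q.1 q.2⟩

/-- The fiber of `F` over `X`, i.e. the set of eigen-decompositions of `X`. -/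
def fiber {p : ℕ} (X : SymPos p) : Set (M p) := F ⁻¹' {X}

/-! ### Stabilizers and their identity components -/

theorem SO.coe_inv {p : ℕ} (R : SO p) :
    ((R⁻¹ : SO p) : Matrix (Fin p) (Fin p) ℝ) = R.1ᵀ := rfl

theorem SO.mul_transpose {p : ℕ} (R : SO p) : R.1 * R.1ᵀ = 1 :=
  (Matrix.mem_orthogonalGroup_iff (Fin p) ℝ).1
    (Matrix.mem_specialOrthogonalGroup_iff.1 R.2).1

theorem SO.transpose_mul {p : ℕ} (R : SO p) : R.1ᵀ * R.1 = 1 :=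
  mul_eq_one_comm.1 (SO.mul_transpose R)

instance SO.isTopologicalGroup (p : ℕ) : IsTopologicalGroup (SO p) where
  continuous_mul := continuous_mul
  continuous_inv := by
    refine Continuous.subtype_mk (f := fun R : SO p => R.1ᵀ) ?_ _
    exact continuous_subtype_val.matrix_transpose

/-- `G_D`, the stabilizer of `D` under the action `(R, X) ↦ R X Rᵀ` of `SO(p)`. -/
def stab {p : ℕ} (D : DiagPos p) : Subgroup (SO p) where
  carrier := {R | R.1 * D.1 * R.1ᵀ = D.1}
  one_mem' := by simp
  mul_mem' := by
    intro a b ha hb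
    simp only [mem_ofPred_eq] at ha hb ⊢
    calc (a * b).1 * D.1 * (a * b).1ᵀ = a.1 * (b.1 * D.1 * b.1ᵀ) * a.1ᵀ := by
          simp [Matrix.transpose_mul, mul_assoc]
      _ = D.1 := by rw [hb, ha]
  inv_mem' := by
    intro a ha
    simp only [mem_ofPred_eq] at ha ⊢
    rw [SO.coe_inv, Matrix.transpose_transpose]
    calc a.1ᵀ * D.1 * a.1 = a.1ᵀ * (a.1 * D.1 * a.1ᵀ) * a.1 := by rw [ha]
      _ = (a.1ᵀ * a.1) * D.1 * (a.1ᵀ * a.1) := by simp only [mul_assoc]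
      _ = D.1 := by rw [SO.transpose_mul]; simp

/-- `G_D⁰`, the identity component of `G_D`, as a subgroup of `SO(p)`. -/
def stab0 {p : ℕ} (D : DiagPos p) : Subgroup (SO p) :=
  (Subgroup.connectedComponentOfOne (stab D)).map (stab D).subtype

/-- `[(U, D)] = {(U R, D) : R ∈ G_D⁰}`, the connected component of the fiber through `(U, D)`. -/
def fiberComponent {p : ℕ} (U : SO p) (D : DiagPos p) : Set (M p) :=
  {q | ∃ R ∈ stab0 D, q = (U * R, D)}

/-! ### Even signed permutations -/

theorem SO.abs_entry_le_one {p : ℕ} (R : SO p) (i j : Fin p) : |R.1 i j| ≤ 1 := by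
  have h := entry_norm_bound_of_unitary
    (Matrix.mem_specialOrthogonalGroup_iff.1 R.2).1 i j
  simpa using h

theorem SO.entry_of_int {p : ℕ} (R : SO p) (i j : Fin p) (z : ℤ) (hz : R.1 i j = z) :
    R.1 i j = 0 ∨ R.1 i j = 1 ∨ R.1 i j = -1 := by
  have h := SO.abs_entry_le_one R i j
  rw [hz] at h ⊢
  have h' : |z| ≤ 1 := by exact_mod_cast h
  rw [abs_le] at h'
  have : z = 0 ∨ z = 1 ∨ z = -1 := by omega
  rcases this with h | h | h <;> simp [h]

/-- The group of even signed-permutation matrices: the elements of `SO(p)` all of whose entries are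
`0`, `1` or `-1`. -/
def evenSignedPerm (p : ℕ) : Subgroup (SO p) where
  carrier := {R | ∀ i j, R.1 i j = 0 ∨ R.1 i j = 1 ∨ R.1 i j = -1}
  one_mem' := by
    intro i j
    by_cases h : i = j <;> simp [h]
  mul_mem' := by
    intro a b ha hb i j
    have key : ∀ c : SO p, (∀ i j, c.1 i j = 0 ∨ c.1 i j = 1 ∨ c.1 i j = -1) →
        ∀ i j, ∃ z : ℤ, c.1 i j = z := by
      intro c hc i j
      rcases hc i j with h | h | h
      · exact ⟨0, by simp [h]⟩
      · exact ⟨1, by simp [h]⟩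
      · exact ⟨-1, by simp [h]⟩
    choose za hza using key a ha
    choose zb hzb using key b hb
    refine SO.entry_of_int (a * b) i j (∑ l, za i l * zb l j) ?_
    rw [Submonoid.coe_mul, Matrix.mul_apply]
    push_cast
    exact Finset.sum_congr rfl fun l _ => by rw [hza, hzb]
  inv_mem' := by
    intro a ha i j
    exact ha j i

theorem evenSignedPerm.exists_perm {p : ℕ} (g : evenSignedPerm p) :
    ∃ π : Equiv.Perm (Fin p), ∀ i j, g.1.1 j i ≠ 0 ↔ j = π i := by
  have hsq : ∀ i j, g.1.1 i j ≠ 0 → g.1.1 i j * g.1.1 i j = 1 := by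
    intro i j h
    rcases g.2 i j with h' | h' | h'
    · exact absurd h' h
    · simp [h']
    · simp [h']
  have hcol : ∀ i, ∑ j, g.1.1 j i * g.1.1 j i = 1 := by
    intro i
    have h := congrFun (congrFun (SO.transpose_mul g.1) i) i
    simpa [Matrix.mul_apply] using h
  have hrow : ∀ j, ∑ i, g.1.1 j i * g.1.1 j i = 1 := by
    intro j
    have h := congrFun (congrFun (SO.mul_transpose g.1) j) j
    simpa [Matrix.mul_apply] using h
  have uniq : ∀ f : Fin p → ℝ, ∑ i, f i * f i = 1 → (∀ i, f i ≠ 0 → f i * f i = 1) →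
      ∀ a b, f a ≠ 0 → f b ≠ 0 → a = b := by
    intro f hf h1 a b ha hb
    by_contra hab
    have h2 : ∑ i ∈ ({a, b} : Finset (Fin p)), f i * f i ≤ ∑ i, f i * f i :=
      Finset.sum_le_sum_of_subset_of_nonneg (Finset.subset_univ _)
        fun i _ _ => mul_self_nonneg _
    rw [Finset.sum_pair hab, h1 a ha, h1 b hb, hf] at h2
    norm_num at h2
  have hex : ∀ i, ∃ j, g.1.1 j i ≠ 0 := by
    intro i
    by_contra! h
    have := hcol i
    simp [h] at this
  choose f hf using hex
  have hinj : Function.Injective f := by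
    intro a b hab
    refine uniq (fun i => g.1.1 (f a) i) (hrow _) (fun i => hsq _ i) a b (hf a) ?_
    simpa [hab] using hf b
  refine ⟨Equiv.ofBijective f (Finite.injective_iff_bijective.1 hinj), fun i j => ?_⟩
  constructor
  · intro h
    exact uniq (fun j => g.1.1 j i) (hcol i) (fun j => hsq j i) j (f i) h (hf i)
  · rintro rfl
    exact hf i

/-- The permutation `π_g` underlying an even signed-permutation `g`: the one for which the `i`-th
standard basis vector is sent by `P_g` to plus or minus the `π_g(i)`-th one. -/
def evenSignedPerm.perm {p : ℕ} (g : evenSignedPerm p) : Equiv.Perm (Fin p) :=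
  (evenSignedPerm.exists_perm g).choose

/-- The left action of `S_p` on `Diag⁺(p)` that permutes the diagonal entries:
`(π • D)_{π(i) π(i)} = D_{i i}`. -/
def permAct {p : ℕ} (π : Equiv.Perm (Fin p)) (D : DiagPos p) : DiagPos p :=
  ⟨D.1.submatrix π.symm π.symm,
    fun _ _ h => D.2.1 (π.symm.injective.ne h), fun i => D.2.2 (π.symm i)⟩

/-- `Γ_D⁰`, the group of even signed-permutations whose matrix lies in `G_D⁰`. -/
def Gamma0 {p : ℕ} (D : DiagPos p) : Subgroup (evenSignedPerm p) :=
  (stab0 D).subgroupOf (evenSignedPerm p)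

/-- `Z` contains exactly one element of each `(H₁, H₂)` double coset. -/
def IsDoubleCosetReps {G : Type*} [Group G] (H₁ H₂ : Subgroup G) (Z : Set G) : Prop :=
  ∀ q : DoubleCoset.Quotient (H₁ : Set G) (H₂ : Set G),
    ∃! z, z ∈ Z ∧ DoubleCoset.mk H₁ H₂ z = q

/-! ### Riemannian metrics, lengths and geodesic distances -/

attribute [local instance] Matrix.frobeniusNormedAddCommGroup Matrix.frobeniusNormedSpace

/-- The bi-invariant Riemannian metric on `SO(p)` that is `-tr(A₁ A₂) / 2` at the identity;
`W₁`, `W₂` are tangent vectors at `U`. -/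
def metricSO {p : ℕ} (U : SO p) (W₁ W₂ : Matrix (Fin p) (Fin p) ℝ) : ℝ :=
  -(1 / 2) * Matrix.trace ((U.1⁻¹ * W₁) * (U.1⁻¹ * W₂))

/-- The bi-invariant Riemannian metric on `Diag⁺(p)`. -/
def metricDiag {p : ℕ} (D : DiagPos p) (L₁ L₂ : Matrix (Fin p) (Fin p) ℝ) : ℝ :=
  Matrix.trace (D.1⁻¹ * L₁ * D.1⁻¹ * L₂)

/-- A curve in a normed space, considered on `[0, 1]`, is piecewise smooth: `[0, 1]` is cut into
finitely many closed intervals, on each of which the curve is smooth up to the end points. -/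
def IsPiecewiseSmooth {E : Type*} [NormedAddCommGroup E] [NormedSpace ℝ E] (c : ℝ → E) : Prop :=
  ∃ (n : ℕ) (t : ℕ → ℝ), Monotone t ∧ t 0 = 0 ∧ t n = 1 ∧
    ∀ i < n, ContDiffOn ℝ ∞ c (Icc (t i) (t (i + 1)))

/-- A curve on `[0, 1]`, extended to `ℝ` by its end values. Only its behaviour on `[0, 1]` is used
below. -/
abbrev extend {α : Type*} (γ : unitInterval → α) : ℝ → α :=
  IccExtend (zero_le_one (α := ℝ)) γ

/-- Piecewise smooth curves `[0, 1] → SO(p)`. -/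
def IsPiecewiseSmoothSO {p : ℕ} (c : unitInterval → SO p) : Prop :=
  IsPiecewiseSmooth fun t : ℝ => (extend c t).1

/-- The length of a curve in `SO(p)`. -/
def lengthSO {p : ℕ} (c : unitInterval → SO p) : ℝ :=
  ∫ t in (0 : ℝ)..1, Real.sqrt (metricSO (extend c t)
    (deriv (fun s => (extend c s).1) t) (deriv (fun s => (extend c s).1) t))

/-- The geodesic distance on `SO(p)`: the infimum of the lengths of the piecewise smooth curves
that join two points. -/
def distSO {p : ℕ} (U V : SO p) : ℝ :=
  sInf {l | ∃ c : unitInterval → SO p,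
    IsPiecewiseSmoothSO c ∧ c 0 = U ∧ c 1 = V ∧ l = lengthSO c}

/-- Piecewise smooth curves `[0, 1] → M(p)`. -/
def IsPiecewiseSmoothM {p : ℕ} (γ : unitInterval → M p) : Prop :=
  IsPiecewiseSmooth fun t : ℝ => ((extend γ t).1.1, (extend γ t).2.1)

/-- The speed of a curve in `M(p)` with respect to the product Riemannian metric
`k g_{SO} ⊕ g_{Diag⁺}`. -/
def speedM {p : ℕ} (k : ℝ) (γ : unitInterval → M p) (t : ℝ) : ℝ :=
  Real.sqrt
    (k * metricSO (extend γ t).1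
        (deriv (fun s => (extend γ s).1.1) t) (deriv (fun s => (extend γ s).1.1) t) +
      metricDiag (extend γ t).2
        (deriv (fun s => (extend γ s).2.1) t) (deriv (fun s => (extend γ s).2.1) t))

/-- The length of a curve in `M(p)`. -/
def lengthM {p : ℕ} (k : ℝ) (γ : unitInterval → M p) : ℝ :=
  ∫ t in (0 : ℝ)..1, speedM k γ t

/-- The geodesic distance on `M(p)`. -/
def distM {p : ℕ} (k : ℝ) (q₀ q₁ : M p) : ℝ :=
  sInf {l | ∃ γ : unitInterval → M p,
    IsPiecewiseSmoothM γ ∧ γ 0 = q₀ ∧ γ 1 = q₁ ∧ l = lengthM k γ}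

/-! ### Scaling-rotation distance and minimal smooth scaling-rotation curves -/

/-- The scaling-rotation distance: the infimum of the distances between points of two fibers. -/
def distSR {p : ℕ} (k : ℝ) (X Y : SymPos p) : ℝ :=
  sInf {l | ∃ q₀ ∈ fiber X, ∃ q₁ ∈ fiber Y, l = distM k q₀ q₁}

/-- `F`-minimal geodesics from the fiber over `X` to the fiber over `Y`. -/
structure IsFMinimalGeodesic {p : ℕ} (k : ℝ) (X Y : SymPos p) (γ : unitInterval → M p) :
    Prop where
  piecewiseSmooth : IsPiecewiseSmoothM γ
  source_mem : γ 0 ∈ fiber X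
  target_mem : γ 1 ∈ fiber Y
  length_eq : lengthM k γ = distSR k X Y

/-- The curve is parametrized proportionally to arc length. -/
def HasConstantSpeed {p : ℕ} (k : ℝ) (γ : unitInterval → M p) : Prop :=
  ∀ s ∈ Icc (0 : ℝ) 1, ∫ t in (0 : ℝ)..s, speedM k γ t = s * lengthM k γ

/-- Minimal pairs: the pairs of end points of `F`-minimal geodesics. -/
def IsMinimalPair {p : ℕ} (k : ℝ) (X Y : SymPos p) (q₀ q₁ : M p) : Prop :=
  ∃ γ, IsFMinimalGeodesic k X Y γ ∧ γ 0 = q₀ ∧ γ 1 = q₁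

/-- Minimal smooth scaling-rotation (MSSR) curves from `X` to `Y`. -/
def IsMSSRCurve {p : ℕ} (k : ℝ) (X Y : SymPos p) (χ : unitInterval → SymPos p) : Prop :=
  ∃ γ, IsFMinimalGeodesic k X Y γ ∧ χ = F ∘ γ

/-- The MSSR curve `χ` corresponds to the pair `(q₀, q₁)`: it is the projection of an `F`-minimal
geodesic with these end points. -/
def CorrespondsTo {p : ℕ} (k : ℝ) (X Y : SymPos p) (χ : unitInterval → SymPos p)
    (q₀ q₁ : M p) : Prop :=
  ∃ γ, IsFMinimalGeodesic k X Y γ ∧ χ = F ∘ γ ∧ γ 0 = q₀ ∧ γ 1 = q₁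

/-! ### The right-hand side of the distance formula -/

/-- The distances `d_{SO}(U R_U, V R_V P_g⁻¹)` with `R_U ∈ G_D⁰`, `R_V ∈ G_Λ⁰`. -/
def rotationDistances {p : ℕ} (g : evenSignedPerm p) (q r : M p) : Set ℝ :=
  {l | ∃ RU ∈ stab0 q.2, ∃ RV ∈ stab0 r.2,
    l = distSO (q.1 * RU) (r.1 * RV * (g : SO p)⁻¹)}

/-- The rotation distance, minimized over the identity components of the two stabilizers. -/
def minRotationDist {p : ℕ} (g : evenSignedPerm p) (q r : M p) : ℝ :=
  sInf (rotationDistances g q r)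

/-- The logarithm of a diagonal matrix with positive diagonal entries. -/
def diagLog {p : ℕ} (D : Matrix (Fin p) (Fin p) ℝ) : Matrix (Fin p) (Fin p) ℝ :=
  Matrix.diagonal fun i => Real.log (D i i)

/-- The Frobenius norm `‖log(D⁻¹ Λ)‖`. -/
def logRatioNorm {p : ℕ} (D Λ : DiagPos p) : ℝ := ‖diagLog (D.1⁻¹ * Λ.1)‖

end

end ScalingRotation

/-!
The group of even signed permutations acts on `M(p)` by `(U, D) ↦ (U P_g, P_g⁻¹ D P_g)`. The action
preserves the metric and the fibers of `F`, and together with `G_D⁰` it generates the whole fiber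
from one eigen-decomposition `(U, D)`: every other one is `(U R P_g⁻¹, π_g · D)` with `R ∈ G_D⁰`
(`exists_mul_eq_of_mem_fiber`). Hence the translate of a curve that starts in the fiber over `X` by a
suitable `P_g` starts in `[(U, D)]`, and has the same speed and the same projection; this gives the
assertions on curves. The distance between two eigen-decompositions equals, after translation, the
distance between a point of `[(U, D)]` and one of the form `(V R_V P_g⁻¹, π_g · Λ)`, so that `d_SR` is
a minimum over the finite group of even signed permutations. The expression to be minimized does not
increase when `g` is multiplied by elements of `Γ_D⁰` and `Γ_Λ⁰` (`signedPermCost_mul_mul_le`), so one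
element of each double coset suffices.

That the fiber is so generated rests on `G_D` being the product of `G_D⁰` and its sign changes
(`exists_stab0_mul_mem_evenSignedPerm`). To diagonalize `R ∈ G_D` within its coset, maximize
`tr (N h R)` over `h ∈ G_D⁰`, where `N = diag (1, …, p)`. Stationarity under the rotations in coordinate
planes inside the eigenspaces of `D` says that `S = h R` satisfies `S N = N Sᵀ`; then `S` commutes with
`N²`, so it is diagonal (`exists_mul_diagonal_of_planeRotation_mem`). For `D = 1` the maximizer is the
identity, so the same argument also shows that any two points of `SO(p)` are joined by a smooth curve.

On the metric side it is not necessary to know that minimizing geodesics exist. What is needed is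

* that `d_SO` is continuous (`continuous_distSO`), which makes the inner minima attained: nearby
  points differ by a short one-parameter subgroup `exp (t A)`, and multiplying a curve pointwise by
  `exp (t A)` lengthens it by at most the length of the latter;
* the formula `d_M² = k d_SO² + ‖log (D⁻¹ Λ)‖²` (`distM_eq_sqrt`). The lower bound is the
  Cauchy–Schwarz inequality. For the upper bound an almost minimizing curve `c` in `SO(p)` is combined
  with the geodesic of `Diag⁺(p)`, run in proportion to the arc length of `c`; the arc length is
  regularized to `∫ √(|c'|² + ε²)`, which is smooth wherever `c` is.
-/

namespace ScalingRotation

open MeasureTheory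

/- The ring structure has to be declared first, so that the instances of the underlying normed space
are those of the metric definitions. -/
attribute [local instance] Matrix.frobeniusNormedRing Matrix.frobeniusNormedAlgebra
  Matrix.frobeniusNormedAddCommGroup Matrix.frobeniusNormedSpace

/-! ### The Frobenius norm and the Riemannian metric of `SO(p)` -/

theorem frobenius_norm_sq {p : ℕ} (A : Matrix (Fin p) (Fin p) ℝ) :
    ‖A‖ ^ 2 = ∑ i, ∑ j, A i j ^ 2 := by
  have h0 : 0 ≤ ∑ i, ∑ j, A i j ^ 2 :=
    Finset.sum_nonneg fun i _ => Finset.sum_nonneg fun j _ => sq_nonneg _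
  rw [Matrix.frobenius_norm_def, ← Real.sqrt_eq_rpow]
  simp only [Real.norm_eq_abs, Real.rpow_two, sq_abs]
  exact Real.sq_sqrt h0

theorem frobenius_norm_sq_eq_trace {p : ℕ} (A : Matrix (Fin p) (Fin p) ℝ) :
    ‖A‖ ^ 2 = (Aᵀ * A).trace := by
  rw [frobenius_norm_sq, Finset.sum_comm]
  simp [Matrix.trace, Matrix.mul_apply, sq]

theorem frobenius_norm_transpose {p : ℕ} (A : Matrix (Fin p) (Fin p) ℝ) : ‖Aᵀ‖ = ‖A‖ := by
  rw [← sq_eq_sq₀ (norm_nonneg _) (norm_nonneg _), frobenius_norm_sq, frobenius_norm_sq,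
    Finset.sum_comm]
  rfl

theorem SO.norm_mul_left {p : ℕ} (U : SO p) (A : Matrix (Fin p) (Fin p) ℝ) :
    ‖U.1 * A‖ = ‖A‖ := by
  rw [← sq_eq_sq₀ (norm_nonneg _) (norm_nonneg _), frobenius_norm_sq_eq_trace,
    frobenius_norm_sq_eq_trace, Matrix.transpose_mul, Matrix.mul_assoc, ← Matrix.mul_assoc U.1ᵀ,
    SO.transpose_mul, Matrix.one_mul]

theorem SO.norm_mul_right {p : ℕ} (A : Matrix (Fin p) (Fin p) ℝ) (U : SO p) :
    ‖A * U.1‖ = ‖A‖ := by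
  rw [← frobenius_norm_transpose, Matrix.transpose_mul, ← SO.coe_inv, SO.norm_mul_left,
    frobenius_norm_transpose]

theorem SO.coe_matrix_inv {p : ℕ} (U : SO p) : (U.1)⁻¹ = U.1ᵀ :=
  Matrix.inv_eq_left_inv (SO.transpose_mul U)

theorem metricSO_of_skew {p : ℕ} (U : SO p) (W : Matrix (Fin p) (Fin p) ℝ)
    (hW : Wᵀ * U.1 + U.1ᵀ * W = 0) : metricSO U W W = 1 / 2 * ‖W‖ ^ 2 := by
  have h : U.1ᵀ * W = -(U.1ᵀ * W)ᵀ := by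
    rw [Matrix.transpose_mul, Matrix.transpose_transpose]
    exact eq_neg_of_add_eq_zero_right hW
  have h2 : ‖W‖ ^ 2 = ((U.1ᵀ * W)ᵀ * (U.1ᵀ * W)).trace := by
    rw [← frobenius_norm_sq_eq_trace, ← SO.coe_inv, SO.norm_mul_left]
  rw [metricSO, SO.coe_matrix_inv, h2]
  nth_rewrite 1 [h]
  rw [Matrix.neg_mul, Matrix.trace_neg]
  ring

/-- Also true where `c` is not differentiable, since both sides are then zero. -/
theorem metricSO_deriv {p : ℕ} (c : ℝ → SO p) (t : ℝ) :
    metricSO (c t) (deriv (fun s => (c s).1) t) (deriv (fun s => (c s).1) t) =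
      1 / 2 * ‖deriv (fun s => (c s).1) t‖ ^ 2 := by
  by_cases hd : DifferentiableAt ℝ (fun s => (c s).1) t
  · apply metricSO_of_skew
    have h1 := hd.hasDerivAt
    have h2 : HasDerivAt (fun s => (c s).1ᵀ) (deriv (fun s => (c s).1) t)ᵀ t :=
      ((Matrix.transposeLinearEquiv (Fin p) (Fin p) ℝ
        ℝ).toLinearMap.toContinuousLinearMap.hasFDerivAt.comp_hasDerivAt t h1 :)
    have h3 := h2.mul h1
    have h4 : (fun s => (c s).1ᵀ) * (fun s => (c s).1) = fun _ => 1 := by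
      funext s
      exact SO.transpose_mul (c s)
    rw [h4] at h3
    exact h3.unique (hasDerivAt_const t _)
  · have h0 : deriv (fun s => (c s).1) t = 0 := deriv_zero_of_not_differentiableAt hd
    rw [h0]
    simp [metricSO]

/-! ### Piecewise smooth curves -/

section PiecewiseSmooth

variable {E G : Type*} [NormedAddCommGroup E] [NormedSpace ℝ E] [NormedAddCommGroup G]
  [NormedSpace ℝ G]

theorem exists_mem_Icc_succ {t : ℕ → ℝ} {n : ℕ} (hn : 0 < n) {x : ℝ}
    (hx : x ∈ Icc (t 0) (t n)) : ∃ i < n, x ∈ Icc (t i) (t (i + 1)) := by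
  induction n with
  | zero => omega
  | succ m ih =>
    rcases le_or_gt (t m) x with h | h
    · exact ⟨m, by omega, h, hx.2⟩
    · rcases Nat.eq_zero_or_pos m with h0 | h0
      · subst h0
        exact ⟨0, by omega, hx⟩
      · obtain ⟨i, hi, hxi⟩ := ih h0 ⟨hx.1, h.le⟩
        exact ⟨i, by omega, hxi⟩

/-- It suffices to transfer smoothness on nondegenerate closed subintervals of `[0, 1]`. -/
theorem IsPiecewiseSmooth.transfer {c : ℝ → E} {c' : ℝ → G} (hc : IsPiecewiseSmooth c)
    (h : ∀ a b, 0 ≤ a → a < b → b ≤ 1 → ContDiffOn ℝ ∞ c (Icc a b) →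
      ContDiffOn ℝ ∞ c' (Icc a b)) : IsPiecewiseSmooth c' := by
  obtain ⟨n, t, ht, h0, h1, hs⟩ := hc
  refine ⟨n, t, ht, h0, h1, fun i hi => ?_⟩
  rcases (ht (Nat.le_succ i)).eq_or_lt with he | hlt
  · intro x hx
    have hsub : Icc (t i) (t (i + 1)) = {t i} := by
      rw [show t (i + 1) = t i from he.symm, Icc_self]
    rw [hsub] at hx ⊢
    rw [mem_singleton_iff.1 hx]
    exact contDiffWithinAt_singleton
  · exact h _ _ (h0 ▸ ht (Nat.zero_le i)) hlt (h1 ▸ ht hi) (hs i hi)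

theorem isPiecewiseSmooth_of_contDiffOn {c : ℝ → E} (hc : ContDiffOn ℝ ∞ c (Icc 0 1)) :
    IsPiecewiseSmooth c := by
  refine ⟨1, fun i => (i : ℝ), Nat.mono_cast, by simp, by simp, fun i hi => ?_⟩
  obtain rfl : i = 0 := by omega
  simpa using hc

theorem IsPiecewiseSmooth.continuousOn {c : ℝ → E} (hc : IsPiecewiseSmooth c) :
    ContinuousOn c (Icc 0 1) := by
  obtain ⟨n, t, ht, h0, h1, hs⟩ := hc
  have key : ∀ m ≤ n, ContinuousOn c (Icc (t 0) (t m)) := by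
    intro m
    induction m with
    | zero => intro _; simp
    | succ m ih =>
      intro hm
      rw [← Icc_union_Icc_eq_Icc (ht (Nat.zero_le m)) (ht (Nat.le_succ m))]
      exact (ih (by omega)).union_of_isClosed (hs m (by omega)).continuousOn isClosed_Icc
        isClosed_Icc
  have := key n le_rfl
  rwa [h0, h1] at this

/-- The break points form the finite exceptional set. -/
theorem IsPiecewiseSmooth.exists_deriv_bound {c : ℝ → E} (hc : IsPiecewiseSmooth c) :
    ∃ s : Set ℝ, s.Finite ∧ ∃ C, ∀ x ∈ Ioo (0 : ℝ) 1 \ s,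
      ContDiffAt ℝ ∞ c x ∧ ‖deriv c x‖ ≤ C := by
  obtain ⟨n, t, ht, h0, h1, hs⟩ := hc
  have hn : 0 < n := by
    rcases Nat.eq_zero_or_pos n with h | h
    · subst h; rw [h0] at h1; norm_num at h1
    · exact h
  have hb : ∀ i : ℕ, ∃ C, i < n → ∀ x ∈ Ioo (t i) (t (i + 1)), ‖deriv c x‖ ≤ C := by
    intro i
    by_cases hi : i < n
    · rcases (ht (Nat.le_succ i)).eq_or_lt with he | hlt
      · refine ⟨0, fun _ x hx => ?_⟩
        have : t i < t (i + 1) := hx.1.trans hx.2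
        exact absurd he this.ne
      · have hcont : ContinuousOn (derivWithin c (Icc (t i) (t (i + 1)))) (Icc (t i) (t (i + 1))) :=
          (hs i hi).continuousOn_derivWithin (uniqueDiffOn_Icc hlt) (by simp)
        obtain ⟨C, hC⟩ := isCompact_Icc.exists_bound_of_continuousOn hcont
        refine ⟨C, fun _ x hx => ?_⟩
        rw [← derivWithin_of_mem_nhds (Icc_mem_nhds hx.1 hx.2)]
        exact hC x (Ioo_subset_Icc_self hx)
    · exact ⟨0, fun h => absurd h hi⟩
  choose C hC using hb
  refine ⟨t '' (Iic n), (finite_Iic n).image t, ∑ i ∈ Finset.range n, |C i|, fun x hx => ?_⟩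
  obtain ⟨i, hi, hxi⟩ := exists_mem_Icc_succ hn (t := t) (x := x)
    ⟨by rw [h0]; exact hx.1.1.le, by rw [h1]; exact hx.1.2.le⟩
  have hxo : x ∈ Ioo (t i) (t (i + 1)) := by
    refine ⟨lt_of_le_of_ne hxi.1 fun h => hx.2 ⟨i, ?_, h⟩,
      lt_of_le_of_ne hxi.2 fun h => hx.2 ⟨i + 1, ?_, h.symm⟩⟩
    · exact hi.le
    · exact hi
  refine ⟨(hs i hi).contDiffAt (Icc_mem_nhds hxo.1 hxo.2), ?_⟩
  refine (hC i hi x hxo).trans ((le_abs_self _).trans ?_)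
  exact Finset.single_le_sum (f := fun i => |C i|) (fun _ _ => abs_nonneg _)
    (Finset.mem_range.2 hi)

theorem ae_mem_Ioo_diff {s : Set ℝ} (hs : s.Finite) {a b : ℝ} :
    ∀ᵐ x ∂(volume.restrict (Ioc a b)), x ∈ Ioo a b \ s := by
  rw [ae_restrict_iff' measurableSet_Ioc]
  have h1 : ∀ᵐ x : ℝ, x ∉ insert b s := (hs.insert b).countable.ae_notMem volume
  filter_upwards [h1] with x hx hxI
  exact ⟨⟨hxI.1, lt_of_le_of_ne hxI.2 fun h => hx (by simp [h])⟩, fun h => hx (by simp [h])⟩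

theorem intervalIntegrable_of_bound {s : Set ℝ} (hs : s.Finite) {f : ℝ → ℝ}
    (hf : Measurable f) {C : ℝ} (hC : ∀ x ∈ Ioo (0 : ℝ) 1 \ s, |f x| ≤ C) :
    IntervalIntegrable f volume 0 1 := by
  rw [intervalIntegrable_iff_integrableOn_Ioc_of_le zero_le_one]
  refine Measure.integrableOn_of_bounded (M := C) (by simp) hf.aestronglyMeasurable ?_
  filter_upwards [ae_mem_Ioo_diff hs] with x hx
  exact hC x hx

theorem IsPiecewiseSmooth.intervalIntegrable_comp_deriv [CompleteSpace E] {c : ℝ → E}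
    (hc : IsPiecewiseSmooth c) {φ : E → ℝ} (hφ : Continuous φ)
    (hb : ∀ C, ∃ B, ∀ x, ‖x‖ ≤ C → |φ x| ≤ B) :
    IntervalIntegrable (fun t => φ (deriv c t)) volume 0 1 := by
  obtain ⟨s, hs, C, hC⟩ := hc.exists_deriv_bound
  obtain ⟨B, hB⟩ := hb C
  exact intervalIntegrable_of_bound hs
    (hφ.comp_stronglyMeasurable (stronglyMeasurable_deriv c)).measurable
    fun x hx => hB _ (hC x hx).2

theorem IsPiecewiseSmooth.intervalIntegrable_norm_deriv [CompleteSpace E] {c : ℝ → E}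
    (hc : IsPiecewiseSmooth c) : IntervalIntegrable (fun t => ‖deriv c t‖) volume 0 1 :=
  hc.intervalIntegrable_comp_deriv continuous_norm fun C => ⟨C, fun x hx => by simpa using hx⟩

theorem IsPiecewiseSmooth.norm_sub_le_integral [CompleteSpace E] {c : ℝ → E}
    (hc : IsPiecewiseSmooth c) : ‖c 1 - c 0‖ ≤ ∫ t in (0 : ℝ)..1, ‖deriv c t‖ := by
  obtain ⟨s, hs, C, hC⟩ := hc.exists_deriv_bound
  have hi : IntervalIntegrable (deriv c) volume 0 1 :=
    hc.intervalIntegrable_norm_deriv.mono_fun' (stronglyMeasurable_deriv c).aestronglyMeasurable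
      (Filter.Eventually.of_forall fun _ => le_rfl)
  have h := integral_eq_of_hasDerivAt_off_countable c (deriv c) (a := 0) (b := 1) hs.countable
    (by rw [uIcc_of_le zero_le_one]; exact hc.continuousOn)
    (fun x hx => by
      simp only [zero_le_one, inf_of_le_left, sup_of_le_right] at hx
      exact ((hC x hx).1.differentiableAt (by simp)).hasDerivAt) hi
  rw [← h]
  exact intervalIntegral.norm_integral_le_integral_norm zero_le_one

/-- The integral of a smooth function of the velocity is smooth up to the end points on every
interval on which the curve is. -/
theorem contDiffOn_integral_comp_deriv [CompleteSpace E] {c : ℝ → E} {φ : E → ℝ}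
    (hφ : ContDiff ℝ ∞ φ) (hi : IntervalIntegrable (fun t => φ (deriv c t)) volume 0 1)
    {a b : ℝ} (ha : 0 ≤ a) (hab : a < b) (hb : b ≤ 1) (hc : ContDiffOn ℝ ∞ c (Icc a b)) :
    ContDiffOn ℝ ∞ (fun t => ∫ s in (0 : ℝ)..t, φ (deriv c s)) (Icc a b) := by
  have hu := uniqueDiffOn_Icc hab
  have hg : ContDiffOn ℝ ∞ (fun t => φ (derivWithin c (Icc a b) t)) (Icc a b) :=
    hφ.comp_contDiffOn ((contDiffOn_infty_iff_derivWithin hu).1 hc).2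
  have hd : ∀ x ∈ Icc a b, HasDerivWithinAt
      (fun t => ∫ s in a..t, φ (derivWithin c (Icc a b) s))
      (φ (derivWithin c (Icc a b) x)) (Icc a b) x := by
    intro x hx
    have : Fact (x ∈ Icc a b) := ⟨hx⟩
    refine intervalIntegral.integral_hasDerivWithinAt_right
      ((hg.continuousOn.mono ?_).intervalIntegrable)
      (hg.continuousOn.stronglyMeasurableAtFilter_nhdsWithin measurableSet_Icc x)
      (hg.continuousOn x hx)
    rw [uIcc_of_le hx.1]
    exact Icc_subset_Icc le_rfl hx.2
  have h1 : ContDiffOn ℝ ∞ (fun t => ∫ s in a..t, φ (derivWithin c (Icc a b) s)) (Icc a b) := by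
    rw [contDiffOn_infty_iff_derivWithin hu]
    exact ⟨fun x hx => (hd x hx).differentiableWithinAt,
      hg.congr fun x hx => (hd x hx).derivWithin (hu x hx)⟩
  refine (contDiffOn_const (c := ∫ s in (0 : ℝ)..a, φ (deriv c s))).add h1 |>.congr
    fun x hx => ?_
  have e1 : IntervalIntegrable (fun t => φ (deriv c t)) volume 0 a :=
    hi.mono_set (by rw [uIcc_of_le ha, uIcc_of_le zero_le_one]; gcongr; linarith)
  have e2 : IntervalIntegrable (fun t => φ (deriv c t)) volume a x :=
    hi.mono_set (by
      rw [uIcc_of_le hx.1, uIcc_of_le zero_le_one]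
      exact Icc_subset_Icc ha (hx.2.trans hb))
  rw [← intervalIntegral.integral_add_adjacent_intervals e1 e2]
  congr 1
  rw [intervalIntegral.integral_of_le hx.1, intervalIntegral.integral_of_le hx.1]
  refine integral_congr_ae ?_
  filter_upwards [ae_mem_Ioo_diff finite_empty] with y hy
  rw [derivWithin_of_mem_nhds (Icc_mem_nhds hy.1.1 (hy.1.2.trans_le hx.2))]

/-- Off the finite exceptional set the velocity is continuous, so the integral is differentiable. -/
theorem IsPiecewiseSmooth.hasDerivAt_integral_comp_deriv [CompleteSpace E] {c : ℝ → E}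
    {φ : E → ℝ} (hφ : Continuous φ)
    (hi : IntervalIntegrable (fun t => φ (deriv c t)) volume 0 1) {x : ℝ}
    (hx : x ∈ Ioo (0 : ℝ) 1) (hc : ContDiffAt ℝ ∞ c x) :
    HasDerivAt (fun t => ∫ s in (0 : ℝ)..t, φ (deriv c s)) (φ (deriv c x)) x := by
  have hcont : ContinuousAt (deriv c) x := by
    have := (hc.fderiv_right (m := 0) (by simp)).continuousAt
    exact (this.clm_apply continuousAt_const :)
  refine intervalIntegral.integral_hasDerivAt_right (hi.mono_set ?_)
    ((hφ.comp_stronglyMeasurable (stronglyMeasurable_deriv c)).stronglyMeasurableAtFilter)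
    (hφ.continuousAt.comp hcont)
  rw [uIcc_of_le hx.1.le, uIcc_of_le zero_le_one]
  exact Icc_subset_Icc le_rfl hx.2.le

end PiecewiseSmooth

/-! ### One-parameter subgroups of `SO(p)` -/

theorem exp_skew_mul_transpose {p : ℕ} {A : Matrix (Fin p) (Fin p) ℝ} (hA : Aᵀ = -A) :
    NormedSpace.exp A * (NormedSpace.exp A)ᵀ = 1 := by
  rw [← Matrix.exp_transpose, hA, ← Matrix.exp_add_of_commute A (-A) (Commute.refl A).neg_right,
    add_neg_cancel, NormedSpace.exp_zero]

theorem exp_skew_mem {p : ℕ} {A : Matrix (Fin p) (Fin p) ℝ} (hA : Aᵀ = -A) :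
    NormedSpace.exp A ∈ Matrix.specialOrthogonalGroup (Fin p) ℝ := by
  rw [Matrix.mem_specialOrthogonalGroup_iff]
  refine ⟨(Matrix.mem_orthogonalGroup_iff _ _).2 (exp_skew_mul_transpose hA), ?_⟩
  -- the determinant is `±1`, and it is a square since `exp A = (exp (A / 2)) ^ 2`
  have h1 : (NormedSpace.exp A).det * (NormedSpace.exp A).det = 1 := by
    have := congrArg Matrix.det (exp_skew_mul_transpose hA)
    rwa [Matrix.det_mul, Matrix.det_transpose, Matrix.det_one] at this
  have h2 : (NormedSpace.exp A).det =
      (NormedSpace.exp ((1 / 2 : ℝ) • A)).det * (NormedSpace.exp ((1 / 2 : ℝ) • A)).det := by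
    rw [← Matrix.det_mul, ← Matrix.exp_add_of_commute _ _ (Commute.refl _), ← add_smul]
    norm_num
  have h3 : 0 ≤ (NormedSpace.exp A).det := h2 ▸ mul_self_nonneg _
  nlinarith

/-- The one-parameter subgroup `t ↦ exp (t A)` of `SO(p)`, for skew-symmetric `A`. -/
noncomputable def expSO {p : ℕ} (A : Matrix (Fin p) (Fin p) ℝ) (hA : Aᵀ = -A) (t : ℝ) : SO p :=
  ⟨NormedSpace.exp (t • A), exp_skew_mem (by rw [Matrix.transpose_smul, hA, smul_neg])⟩

theorem expSO_zero {p : ℕ} {A : Matrix (Fin p) (Fin p) ℝ} (hA : Aᵀ = -A) : expSO A hA 0 = 1 := by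
  apply Subtype.ext
  simp [expSO]

theorem hasDerivAt_expSO {p : ℕ} {A : Matrix (Fin p) (Fin p) ℝ} (hA : Aᵀ = -A) (t : ℝ) :
    HasDerivAt (fun s => (expSO A hA s).1) ((expSO A hA t).1 * A) t :=
  hasDerivAt_exp_smul_const (𝕂 := ℝ) A t

theorem contDiff_expSO {p : ℕ} {A : Matrix (Fin p) (Fin p) ℝ} (hA : Aᵀ = -A) :
    ContDiff ℝ ∞ (fun s => (expSO A hA s).1) := by
  have h : ContDiff ℝ ∞ (NormedSpace.exp : Matrix (Fin p) (Fin p) ℝ → _) :=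
    contDiff_iff_contDiffAt.2 fun x => (NormedSpace.exp_analytic (𝕂 := ℝ) x).contDiffAt
  exact h.comp (contDiff_id.smul contDiff_const)

/-- The exponential map is a local homeomorphism at `0`; since `A` and `-Aᵀ` have the same
exponential when that is orthogonal, local injectivity makes the logarithms skew-symmetric. -/
theorem eventually_eq_expSO {p : ℕ} {ε : ℝ} (hε : 0 < ε) :
    ∀ᶠ W in nhds (1 : SO p), ∃ (A : Matrix (Fin p) (Fin p) ℝ) (hA : Aᵀ = -A),
      ‖A‖ < ε ∧ W = expSO A hA 1 := by
  have hs : HasStrictFDerivAt (NormedSpace.exp : Matrix (Fin p) (Fin p) ℝ → _)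
      ((ContinuousLinearEquiv.refl ℝ (Matrix (Fin p) (Fin p) ℝ) : _ ≃L[ℝ] _) : _ →L[ℝ] _) 0 :=
    hasStrictFDerivAt_exp_zero (𝕂 := ℝ) (𝔸 := Matrix (Fin p) (Fin p) ℝ)
  have hmap := hs.map_nhds_eq_of_equiv
  rw [NormedSpace.exp_zero] at hmap
  have hinv := hs.eventually_left_inverse
  have hneg : Filter.Tendsto (fun A : Matrix (Fin p) (Fin p) ℝ => -Aᵀ) (nhds 0) (nhds 0) := by
    have : Continuous (fun A : Matrix (Fin p) (Fin p) ℝ => -Aᵀ) :=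
      (continuous_id.matrix_transpose).neg
    simpa using this.tendsto 0
  have hball : ∀ᶠ A in nhds (0 : Matrix (Fin p) (Fin p) ℝ), ‖A‖ < ε := by
    have := Metric.ball_mem_nhds (0 : Matrix (Fin p) (Fin p) ℝ) hε
    filter_upwards [this] with A hA
    simpa using hA
  have hT := (hinv.and (hneg.eventually hinv)).and hball
  have him : NormedSpace.exp '' {A : Matrix (Fin p) (Fin p) ℝ | _} ∈
      nhds (1 : Matrix (Fin p) (Fin p) ℝ) := hmap ▸ Filter.image_mem_map hT
  have hc : Filter.Tendsto (fun W : SO p => W.1) (nhds 1) (nhds 1) :=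
    continuous_subtype_val.tendsto (1 : SO p)
  filter_upwards [hc him] with W hW
  obtain ⟨A, ⟨⟨h1, h2⟩, h3⟩, hAW⟩ := hW
  have hexp : NormedSpace.exp (-Aᵀ) = NormedSpace.exp A := by
    rw [Matrix.exp_neg, Matrix.exp_transpose, hAW, ← SO.coe_inv, SO.coe_matrix_inv, SO.coe_inv,
      Matrix.transpose_transpose]
  have hA : -Aᵀ = A := by
    rw [hexp, h1] at h2
    exact h2.symm
  have hA' : Aᵀ = -A := by rw [← neg_eq_iff_eq_neg, hA]
  refine ⟨A, hA', h3, Subtype.ext ?_⟩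
  simp only [expSO, one_smul]
  exact hAW.symm

/-! ### The geodesic distance of `SO(p)` -/

theorem extend_apply_of_mem {α : Type*} {g : ℝ → α} {t : ℝ} (ht : t ∈ Icc (0 : ℝ) 1) :
    extend (fun u : unitInterval => g u) t = g t :=
  IccExtend_of_mem _ _ ht

theorem extend_zero {α : Type*} (γ : unitInterval → α) : extend γ 0 = γ 0 :=
  IccExtend_of_mem _ _ (left_mem_Icc.2 zero_le_one)

theorem extend_one {α : Type*} (γ : unitInterval → α) : extend γ 1 = γ 1 :=
  IccExtend_of_mem _ _ (right_mem_Icc.2 zero_le_one)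

/-- Also true where `f` is not differentiable, since both sides are then zero. -/
theorem deriv_mul_SO {p : ℕ} (R S : SO p) (f : ℝ → Matrix (Fin p) (Fin p) ℝ) (t : ℝ) :
    deriv (fun s => R.1 * f s * S.1) t = R.1 * deriv f t * S.1 := by
  by_cases hf : DifferentiableAt ℝ f t
  · exact ((hf.hasDerivAt.const_mul R.1).mul_const S.1).deriv
  · have h0 : deriv f t = 0 := deriv_zero_of_not_differentiableAt hf
    rw [h0, Matrix.mul_zero, Matrix.zero_mul]
    refine deriv_zero_of_not_differentiableAt fun h => hf ?_
    have h2 : DifferentiableAt ℝ (fun s => R.1ᵀ * (R.1 * f s * S.1) * S.1ᵀ) t :=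
      (h.const_mul R.1ᵀ).mul_const S.1ᵀ
    have e : (fun s => R.1ᵀ * (R.1 * f s * S.1) * S.1ᵀ) = f := by
      funext s
      rw [Matrix.mul_assoc R.1, ← Matrix.mul_assoc R.1ᵀ, SO.transpose_mul, Matrix.one_mul,
        Matrix.mul_assoc, SO.mul_transpose, Matrix.mul_one]
    rwa [e] at h2

theorem contDiffOn_mul_SO {p : ℕ} (R S : SO p) {f : ℝ → Matrix (Fin p) (Fin p) ℝ} {s : Set ℝ}
    (hf : ContDiffOn ℝ ∞ f s) : ContDiffOn ℝ ∞ (fun t => R.1 * f t * S.1) s :=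
  (contDiffOn_const.mul hf).mul contDiffOn_const

theorem lengthSO_eq {p : ℕ} (c : unitInterval → SO p) :
    lengthSO c = ∫ t in (0 : ℝ)..1, √(1 / 2) * ‖deriv (fun s => (extend c s).1) t‖ := by
  unfold lengthSO
  refine intervalIntegral.integral_congr fun t _ => ?_
  rw [metricSO_deriv (extend c) t, Real.sqrt_mul (by norm_num), Real.sqrt_sq (norm_nonneg _)]

theorem lengthSO_nonneg {p : ℕ} (c : unitInterval → SO p) : 0 ≤ lengthSO c :=
  intervalIntegral.integral_nonneg zero_le_one fun _ _ => Real.sqrt_nonneg _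

theorem distSO_nonneg {p : ℕ} (U V : SO p) : 0 ≤ distSO U V := by
  apply Real.sInf_nonneg
  rintro l ⟨c, -, -, -, rfl⟩
  exact lengthSO_nonneg c

theorem distSO_le_lengthSO {p : ℕ} {U V : SO p} {c : unitInterval → SO p}
    (hc : IsPiecewiseSmoothSO c) (h0 : c 0 = U) (h1 : c 1 = V) : distSO U V ≤ lengthSO c :=
  csInf_le ⟨0, by rintro l ⟨c, -, -, -, rfl⟩; exact lengthSO_nonneg c⟩ ⟨c, hc, h0, h1, rfl⟩

theorem distSO_mul_mul {p : ℕ} (R S U V : SO p) :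
    distSO (R * U * S) (R * V * S) = distSO U V := by
  have key : ∀ R S U V : SO p, ∀ l, (∃ c : unitInterval → SO p,
      IsPiecewiseSmoothSO c ∧ c 0 = U ∧ c 1 = V ∧ l = lengthSO c) → ∃ c : unitInterval → SO p,
      IsPiecewiseSmoothSO c ∧ c 0 = R * U * S ∧ c 1 = R * V * S ∧ l = lengthSO c := by
    rintro R S U V l ⟨c, hc, h0, h1, rfl⟩
    refine ⟨fun t => R * c t * S, hc.transfer fun a b _ _ _ h => contDiffOn_mul_SO R S h,
      by simp only [h0], by simp only [h1], ?_⟩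
    rw [lengthSO_eq, lengthSO_eq]
    congr 1
    funext t
    have : deriv (fun s => (extend (fun t => R * c t * S) s).1) t =
        R.1 * deriv (fun s => (extend c s).1) t * S.1 := deriv_mul_SO R S _ t
    rw [this, SO.norm_mul_right, SO.norm_mul_left]
  unfold distSO
  congr 1
  ext l
  refine ⟨fun h => ?_, key R S U V l⟩
  have := key R⁻¹ S⁻¹ _ _ l h
  simpa [mul_assoc] using this

theorem distSO_eq_one {p : ℕ} (U V : SO p) : distSO U V = distSO 1 (U⁻¹ * V) := by
  simpa using (distSO_mul_mul U⁻¹ 1 U V).symm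

/-- The subgroup of `SO(p)` of end points of smooth curves that start at the identity. Smooth rather
than piecewise smooth curves are used because their pointwise products need no common subdivision. -/
def smoothlyReachable (p : ℕ) : Subgroup (SO p) where
  carrier := {W | ∃ g : ℝ → SO p, ContDiff ℝ ∞ (fun t => (g t).1) ∧ g 0 = 1 ∧ g 1 = W}
  one_mem' := ⟨fun _ => 1, contDiff_const, rfl, rfl⟩
  mul_mem' := by
    rintro _ _ ⟨g, hg, g0, rfl⟩ ⟨h, hh, h0, rfl⟩
    exact ⟨fun t => g t * h t, hg.mul hh, by simp only [g0, h0, one_mul], rfl⟩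
  inv_mem' := by
    rintro _ ⟨g, hg, g0, rfl⟩
    refine ⟨fun t => (g t)⁻¹, ?_, by simp only [g0, inv_one], rfl⟩
    exact ((Matrix.transposeLinearEquiv (Fin p) (Fin p) ℝ
        ℝ).toLinearMap.toContinuousLinearMap.contDiff.comp hg :)

theorem expSO_mem_smoothlyReachable {p : ℕ} {A : Matrix (Fin p) (Fin p) ℝ} (hA : Aᵀ = -A)
    (t : ℝ) : expSO A hA t ∈ smoothlyReachable p := by
  refine ⟨fun s => expSO A hA (s * t), ?_, ?_, ?_⟩
  · exact (contDiff_expSO hA).comp (contDiff_id.mul contDiff_const)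
  · simp only [zero_mul, expSO_zero]
  · simp only [one_mul]

/-- The subgroup contains a neighbourhood of the identity, so it is open, hence closed. -/
theorem isClosed_smoothlyReachable (p : ℕ) : IsClosed (smoothlyReachable p : Set (SO p)) := by
  refine Subgroup.isClosed_of_isOpen _ (Subgroup.isOpen_of_mem_nhds _ (g := 1) ?_)
  filter_upwards [eventually_eq_expSO (p := p) zero_lt_one] with W hW
  obtain ⟨A, hA, -, rfl⟩ := hW
  exact expSO_mem_smoothlyReachable hA 1

theorem exists_curve_of_mem_smoothlyReachable {p : ℕ} {U V : SO p}
    (h : U⁻¹ * V ∈ smoothlyReachable p) :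
    ∃ c : unitInterval → SO p, IsPiecewiseSmoothSO c ∧ c 0 = U ∧ c 1 = V := by
  obtain ⟨g, hg, g0, g1⟩ := h
  refine ⟨fun t => U * g t, ?_, by simp [g0], by simp [g1]⟩
  refine isPiecewiseSmooth_of_contDiffOn ?_
  refine ((contDiff_const (c := U.1)).mul hg).contDiffOn.congr fun t ht => ?_
  rw [extend_apply_of_mem (g := fun t => U * g t) ht]
  rfl

/-- Multiplying a curve pointwise by `t ↦ exp (t A)` lengthens it by at most the length of the
latter; this replaces concatenation of curves. -/
theorem exists_curve_mul_expSO {p : ℕ} {c : unitInterval → SO p} (hc : IsPiecewiseSmoothSO c)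
    {A : Matrix (Fin p) (Fin p) ℝ} (hA : Aᵀ = -A) :
    ∃ c' : unitInterval → SO p, IsPiecewiseSmoothSO c' ∧ c' 0 = c 0 ∧
      c' 1 = c 1 * expSO A hA 1 ∧ lengthSO c' ≤ lengthSO c + √(1 / 2) * ‖A‖ := by
  have hext : ∀ s ∈ Icc (0 : ℝ) 1, (extend (fun t : unitInterval => c t * expSO A hA t) s).1 =
      (extend c s).1 * (expSO A hA s).1 := by
    intro s hs
    rw [extend, extend, IccExtend_of_mem _ _ hs, IccExtend_of_mem _ _ hs]
    rfl
  have hps : IsPiecewiseSmoothSO (fun t : unitInterval => c t * expSO A hA t) := by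
    refine IsPiecewiseSmooth.transfer hc fun a b ha _ hb h => ?_
    exact (h.mul (contDiff_expSO hA).contDiffOn).congr fun s hs =>
      hext s ⟨ha.trans hs.1, hs.2.trans hb⟩
  refine ⟨fun t => c t * expSO A hA t, hps, ?_, ?_, ?_⟩
  · simp [expSO_zero]
  · simp
  rw [lengthSO_eq, lengthSO_eq]
  have hi : IntervalIntegrable (fun t => √(1 / 2) * ‖deriv (fun s => (extend c s).1) t‖)
      volume 0 1 :=
    (IsPiecewiseSmooth.intervalIntegrable_norm_deriv hc).const_mul √(1 / 2)
  have hi' := (IsPiecewiseSmooth.intervalIntegrable_norm_deriv hps).const_mul √(1 / 2)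
  obtain ⟨s, hs, C, hC⟩ := IsPiecewiseSmooth.exists_deriv_bound hc
  have hle : ∫ t in (0 : ℝ)..1, √(1 / 2) * ‖deriv (fun s => (extend
      (fun t : unitInterval => c t * expSO A hA t) s).1) t‖ ≤
      ∫ t in (0 : ℝ)..1, (√(1 / 2) * ‖deriv (fun s => (extend c s).1) t‖ + √(1 / 2) * ‖A‖) := by
    refine intervalIntegral.integral_mono_ae_restrict zero_le_one hi'
      (hi.add intervalIntegrable_const) ?_
    rw [← Measure.restrict_congr_set Ioc_ae_eq_Icc]
    filter_upwards [ae_mem_Ioo_diff hs] with t ht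
    have hd : HasDerivAt (fun s => (extend (fun t : unitInterval => c t * expSO A hA t) s).1)
        (deriv (fun s => (extend c s).1) t * (expSO A hA t).1 +
          (extend c t).1 * ((expSO A hA t).1 * A)) t := by
      refine (((hC t ht).1.differentiableAt (by simp)).hasDerivAt.mul
        (hasDerivAt_expSO hA t)).congr_of_eventuallyEq ?_
      filter_upwards [Icc_mem_nhds ht.1.1 ht.1.2] with s hs using hext s hs
    have hd' : deriv (fun s => (extend (fun t : unitInterval => c t * expSO A hA t) s).1) t =
        deriv (fun s => (extend c s).1) t * (expSO A hA t).1 +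
          (extend c t).1 * ((expSO A hA t).1 * A) := hd.deriv
    rw [hd', ← mul_add]
    refine mul_le_mul_of_nonneg_left ((norm_add_le _ _).trans ?_) (Real.sqrt_nonneg _)
    rw [SO.norm_mul_right, SO.norm_mul_left, SO.norm_mul_left]
  refine hle.trans (le_of_eq ?_)
  rw [intervalIntegral.integral_add hi intervalIntegrable_const]
  simp

/-! ### Plane rotations -/

/-- The generator `E_ij - E_ji` of the rotations in the plane of the `i`-th and `j`-th axes. -/
def planeGenerator {p : ℕ} (i j : Fin p) : Matrix (Fin p) (Fin p) ℝ :=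
  Matrix.single i j 1 - Matrix.single j i 1

theorem planeGenerator_transpose {p : ℕ} (i j : Fin p) :
    (planeGenerator i j)ᵀ = -planeGenerator i j := by
  simp [planeGenerator]

theorem planeGenerator_sq {p : ℕ} {i j : Fin p} (hij : i ≠ j) :
    planeGenerator i j * planeGenerator i j =
      -(Matrix.single i i 1 + Matrix.single j j 1) := by
  simp [planeGenerator, mul_sub, sub_mul, hij, hij.symm]
  abel

theorem planeGenerator_cube {p : ℕ} {i j : Fin p} (hij : i ≠ j) :
    planeGenerator i j * (planeGenerator i j * planeGenerator i j) = -planeGenerator i j := by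
  rw [planeGenerator_sq hij]
  simp [planeGenerator, mul_add, sub_mul, hij, hij.symm]
  abel

/-- Rodrigues' formula for the rotation by `θ` in the plane of the `i`-th and `j`-th axes. -/
noncomputable def planeRotationMatrix {p : ℕ} (i j : Fin p) (θ : ℝ) : Matrix (Fin p) (Fin p) ℝ :=
  1 + Real.sin θ • planeGenerator i j +
    (1 - Real.cos θ) • (planeGenerator i j * planeGenerator i j)

/-- Products of matrices of the form `1 + a A + b A ^ 2` when `A ^ 3 = -A`. -/
theorem rodrigues_mul {p : ℕ} {A : Matrix (Fin p) (Fin p) ℝ} (hA : A * (A * A) = -A)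
    (a b c d : ℝ) :
    (1 + a • A + b • (A * A)) * (1 + c • A + d • (A * A)) =
      1 + (a + c - a * d - b * c) • A + (a * c + b + d - b * d) • (A * A) := by
  have h4 : A * A * (A * A) = -(A * A) := by rw [mul_assoc, hA, mul_neg]
  have h3 : A * A * A = -A := by rw [mul_assoc, hA]
  simp only [mul_add, add_mul, mul_one, one_mul, smul_mul_assoc, mul_smul_comm, hA, h3,
    h4, smul_neg]
  module

theorem planeRotationMatrix_mul_transpose {p : ℕ} {i j : Fin p} (hij : i ≠ j) (θ : ℝ) :
    planeRotationMatrix i j θ * (planeRotationMatrix i j θ)ᵀ = 1 := by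
  have ht : (planeRotationMatrix i j θ)ᵀ = 1 + (-Real.sin θ) • planeGenerator i j +
      (1 - Real.cos θ) • (planeGenerator i j * planeGenerator i j) := by
    simp [planeRotationMatrix, Matrix.transpose_add, Matrix.transpose_mul,
      planeGenerator_transpose]
  rw [ht, planeRotationMatrix, rodrigues_mul (planeGenerator_cube hij)]
  have h1 : Real.sin θ + -Real.sin θ - Real.sin θ * (1 - Real.cos θ) -
      (1 - Real.cos θ) * -Real.sin θ = 0 := by ring
  have h2 : Real.sin θ * -Real.sin θ + (1 - Real.cos θ) + (1 - Real.cos θ) -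
      (1 - Real.cos θ) * (1 - Real.cos θ) = 0 := by
    nlinarith [Real.sin_sq_add_cos_sq θ]
  rw [h1, h2]
  simp

theorem planeRotationMatrix_mul_self {p : ℕ} {i j : Fin p} (hij : i ≠ j) (θ : ℝ) :
    planeRotationMatrix i j θ * planeRotationMatrix i j θ = planeRotationMatrix i j (2 * θ) := by
  rw [planeRotationMatrix, planeRotationMatrix, rodrigues_mul (planeGenerator_cube hij),
    Real.sin_two_mul, Real.cos_two_mul]
  have h1 : Real.sin θ + Real.sin θ - Real.sin θ * (1 - Real.cos θ) -
      (1 - Real.cos θ) * Real.sin θ = 2 * Real.sin θ * Real.cos θ := by ring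
  have h2 : Real.sin θ * Real.sin θ + (1 - Real.cos θ) + (1 - Real.cos θ) -
      (1 - Real.cos θ) * (1 - Real.cos θ) = 1 - (2 * Real.cos θ ^ 2 - 1) := by
    nlinarith [Real.sin_sq_add_cos_sq θ]
  rw [h1, h2]

theorem planeRotationMatrix_mem {p : ℕ} {i j : Fin p} (hij : i ≠ j) (θ : ℝ) :
    planeRotationMatrix i j θ ∈ Matrix.specialOrthogonalGroup (Fin p) ℝ := by
  rw [Matrix.mem_specialOrthogonalGroup_iff]
  refine ⟨(Matrix.mem_orthogonalGroup_iff _ _).2 (planeRotationMatrix_mul_transpose hij θ), ?_⟩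
  have h1 : (planeRotationMatrix i j θ).det * (planeRotationMatrix i j θ).det = 1 := by
    have := congrArg Matrix.det (planeRotationMatrix_mul_transpose hij θ)
    rwa [Matrix.det_mul, Matrix.det_transpose, Matrix.det_one] at this
  have h2 : 0 ≤ (planeRotationMatrix i j θ).det := by
    rw [show θ = 2 * (θ / 2) by ring, ← planeRotationMatrix_mul_self hij, Matrix.det_mul]
    exact mul_self_nonneg _
  nlinarith

/-- The rotation by `θ` in the plane of the `i`-th and `j`-th axes, as an element of `SO(p)`. -/
noncomputable def planeRotation {p : ℕ} {i j : Fin p} (hij : i ≠ j) (θ : ℝ) : SO p :=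
  ⟨planeRotationMatrix i j θ, planeRotationMatrix_mem hij θ⟩

theorem planeRotation_zero {p : ℕ} {i j : Fin p} (hij : i ≠ j) : planeRotation hij 0 = 1 := by
  apply Subtype.ext
  simp [planeRotation, planeRotationMatrix]

theorem contDiff_planeRotation {p : ℕ} {i j : Fin p} (hij : i ≠ j) :
    ContDiff ℝ ∞ (fun θ => (planeRotation hij θ).1) :=
  (contDiff_const.add (Real.contDiff_sin.smul contDiff_const)).add
    ((contDiff_const.sub Real.contDiff_cos).smul contDiff_const)

theorem continuous_planeRotation {p : ℕ} {i j : Fin p} (hij : i ≠ j) :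
    Continuous (planeRotation hij) :=
  Continuous.subtype_mk (contDiff_planeRotation hij).continuous _

theorem planeRotation_mem_smoothlyReachable {p : ℕ} {i j : Fin p} (hij : i ≠ j) (θ : ℝ) :
    planeRotation hij θ ∈ smoothlyReachable p :=
  ⟨fun t => planeRotation hij (t * θ),
    (contDiff_planeRotation hij).comp (contDiff_id.mul contDiff_const),
    by simp only [zero_mul, planeRotation_zero], by simp only [one_mul]⟩

/-! ### Diagonal representatives -/

instance SO.compactSpace (p : ℕ) : CompactSpace (SO p) := by
  refine isCompact_iff_compactSpace.1 ?_
  refine Metric.isCompact_of_isClosed_isBounded (α := Matrix (Fin p) (Fin p) ℝ) ?_ ?_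
  · have : {A : Matrix (Fin p) (Fin p) ℝ | A * Aᵀ = 1 ∧ A.det = 1} =
        (Matrix.specialOrthogonalGroup (Fin p) ℝ : Set (Matrix (Fin p) (Fin p) ℝ)) := by
      ext A
      rw [SetLike.mem_coe, Matrix.mem_specialOrthogonalGroup_iff, Matrix.mem_orthogonalGroup_iff]
      rfl
    have h2 : IsClosed {A : Matrix (Fin p) (Fin p) ℝ | A * Aᵀ = 1 ∧ A.det = 1} :=
      (isClosed_eq (continuous_id.matrix_mul continuous_id.matrix_transpose)
        continuous_const).inter (isClosed_eq continuous_id.matrix_det continuous_const)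
    exact this ▸ h2
  · refine isBounded_iff_forall_norm_le.2 ⟨‖(1 : Matrix (Fin p) (Fin p) ℝ)‖, fun A hA => ?_⟩
    have := SO.norm_mul_left ⟨A, hA⟩ 1
    rw [Matrix.mul_one] at this
    exact this.le

/-- If `S` maximizes `tr (N S)` along all left translates by rotations in the plane of the axes `i`
and `j`, the first-order condition and the comparison with the rotation by `π` give this. -/
theorem entries_of_forall_planeRotation_le {p : ℕ} (N : Fin p → ℝ)
    (S : Matrix (Fin p) (Fin p) ℝ) {i j : Fin p} (hij : i ≠ j)
    (h : ∀ θ, (Matrix.diagonal N * (planeRotationMatrix i j θ * S)).trace ≤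
      (Matrix.diagonal N * S).trace) :
    N i * S j i = N j * S i j ∧ 0 ≤ N i * S i i + N j * S j j := by
  have e1 : (Matrix.diagonal N * (planeGenerator i j * S)).trace =
      N i * S j i - N j * S i j := by
    rw [← Matrix.mul_assoc, Matrix.trace_mul_comm, ← Matrix.mul_assoc, Matrix.trace_mul_comm,
      planeGenerator, Matrix.sub_mul, Matrix.trace_sub]
    simp [Matrix.trace_single_mul, mul_comm]
  have e2 : (Matrix.diagonal N * (planeGenerator i j * planeGenerator i j * S)).trace =
      -(N i * S i i + N j * S j j) := by
    rw [← Matrix.mul_assoc, Matrix.trace_mul_comm, ← Matrix.mul_assoc, Matrix.trace_mul_comm,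
      planeGenerator_sq hij, Matrix.neg_mul, Matrix.add_mul, Matrix.trace_neg, Matrix.trace_add]
    simp [Matrix.trace_single_mul, mul_comm]
  have h' : ∀ θ, Real.sin θ * (N i * S j i - N j * S i j) +
      (1 - Real.cos θ) * (-(N i * S i i + N j * S j j)) ≤ 0 := by
    intro θ
    have := h θ
    rw [planeRotationMatrix, Matrix.add_mul, Matrix.add_mul, Matrix.one_mul, Matrix.mul_add,
      Matrix.mul_add, Matrix.trace_add, Matrix.trace_add, Matrix.smul_mul, Matrix.smul_mul,
      Matrix.mul_smul, Matrix.mul_smul, Matrix.trace_smul, Matrix.trace_smul, e1, e2] at this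
    simp only [smul_eq_mul] at this
    linarith
  constructor
  · have hd : HasDerivAt (fun θ => Real.sin θ * (N i * S j i - N j * S i j) +
        (1 - Real.cos θ) * (-(N i * S i i + N j * S j j)))
        (N i * S j i - N j * S i j) 0 := by
      refine (((Real.hasDerivAt_sin 0).mul_const (N i * S j i - N j * S i j)).add
        (((Real.hasDerivAt_cos 0).const_sub 1).mul_const
          (-(N i * S i i + N j * S j j)))).congr_deriv ?_
      simp
    have hm : IsLocalMax (fun θ => Real.sin θ * (N i * S j i - N j * S i j) +
        (1 - Real.cos θ) * (-(N i * S i i + N j * S j j))) 0 :=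
      Filter.Eventually.of_forall fun θ => by simpa using h' θ
    exact sub_eq_zero.1 (hm.hasDerivAt_eq_zero hd)
  · have := h' Real.pi
    rw [Real.sin_pi, Real.cos_pi] at this
    linarith

/-- An orthogonal matrix `S` with `S N = N Sᵀ` commutes with `N ^ 2`, hence is diagonal when the
entries of the diagonal matrix `N` have distinct squares. -/
theorem SO.entry_eq_zero_of_mul_eq {p : ℕ} (N : Fin p → ℝ)
    (hN : ∀ i j, i ≠ j → N i * N i ≠ N j * N j) (S : SO p)
    (h : ∀ i j, i ≠ j → N i * S.1 j i = N j * S.1 i j) {i j : Fin p} (hij : i ≠ j) :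
    S.1 i j = 0 := by
  have h1 : S.1 * Matrix.diagonal N = Matrix.diagonal N * S.1ᵀ := by
    ext a b
    rw [Matrix.mul_diagonal, Matrix.diagonal_mul, Matrix.transpose_apply]
    rcases eq_or_ne a b with rfl | hab
    · ring
    · rw [h a b hab]; ring
  have h2 : Matrix.diagonal N * S.1 = S.1ᵀ * Matrix.diagonal N := by
    have := congrArg (fun A => S.1ᵀ * (A * S.1)) h1
    rw [Matrix.mul_assoc (Matrix.diagonal N), SO.transpose_mul, Matrix.mul_one, Matrix.mul_assoc,
      ← Matrix.mul_assoc, SO.transpose_mul, Matrix.one_mul] at this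
    exact this
  have h3 : Matrix.diagonal N * (Matrix.diagonal N * S.1) =
      S.1 * Matrix.diagonal N * Matrix.diagonal N := by
    rw [h2, h1, Matrix.mul_assoc]
  have h4 := congrFun (congrFun h3 i) j
  rw [Matrix.diagonal_mul, Matrix.diagonal_mul, Matrix.mul_diagonal, Matrix.mul_diagonal] at h4
  have h5 : (N i * N i - N j * N j) * S.1 i j = 0 := by linarith
  exact (mul_eq_zero.1 h5).resolve_left (sub_ne_zero.2 (hN i j hij))

/-- Let the closed subgroup `K` contain the rotations in all coordinate planes on which `δ` is
constant. A maximizer of `tr (N S)` over the coset `K R`, with `N = diag (1, …, p)`, is diagonal as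
soon as the elements of the coset commute with `diag δ`. -/
theorem exists_mul_diagonal_of_planeRotation_mem {p : ℕ} (K : Subgroup (SO p))
    (hK : IsClosed (K : Set (SO p))) (δ : Fin p → ℝ)
    (hrot : ∀ (i j : Fin p) (hij : i ≠ j), δ i = δ j → ∀ θ, planeRotation hij θ ∈ K) (R : SO p)
    (hR : ∀ h ∈ K, (h * R).1 * Matrix.diagonal δ = Matrix.diagonal δ * (h * R).1) :
    ∃ h ∈ K, (∀ i j, i ≠ j → (h * R).1 i j = 0) ∧
      ∀ i j, i ≠ j → δ i = δ j → ¬((h * R).1 i i = -1 ∧ (h * R).1 j j = -1) := by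
  set N : Fin p → ℝ := fun i => (i : ℝ) + 1 with hNdef
  have hNpos : ∀ i, 0 < N i := fun i => by positivity
  have hN : ∀ i j, i ≠ j → N i * N i ≠ N j * N j := by
    intro i j hij he
    have h1 := (mul_self_inj (hNpos i).le (hNpos j).le).1 he
    simp only [hNdef, add_left_inj, Nat.cast_inj] at h1
    exact hij (Fin.ext h1)
  have hcont : Continuous fun h : SO p => (Matrix.diagonal N * (h * R).1).trace :=
    (continuous_const.matrix_mul
      (continuous_subtype_val.comp (continuous_id.mul continuous_const))).matrix_trace
  obtain ⟨h, hh, hmax⟩ := hK.isCompact.exists_isMaxOn ⟨1, K.one_mem⟩ hcont.continuousOn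
  have key : ∀ i j, i ≠ j → δ i = δ j → N i * (h * R).1 j i = N j * (h * R).1 i j ∧
      0 ≤ N i * (h * R).1 i i + N j * (h * R).1 j j := by
    intro i j hij hδ
    refine entries_of_forall_planeRotation_le N _ hij fun θ => ?_
    have := hmax (K.mul_mem (hrot i j hij hδ θ) hh)
    simpa [mul_assoc, planeRotation] using this
  have hoff : ∀ i j, δ i ≠ δ j → (h * R).1 i j = 0 := by
    intro i j hδ
    have := congrFun (congrFun (hR h hh) i) j
    rw [Matrix.mul_diagonal, Matrix.diagonal_mul] at this
    have h5 : (δ i - δ j) * (h * R).1 i j = 0 := by linarith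
    exact (mul_eq_zero.1 h5).resolve_left (sub_ne_zero.2 hδ)
  refine ⟨h, hh, fun i j hij => ?_, fun i j hij hδ hs => ?_⟩
  · refine SO.entry_eq_zero_of_mul_eq N hN (h * R) (fun a b hab => ?_) hij
    by_cases hδ : δ a = δ b
    · exact (key a b hab hδ).1
    · rw [hoff a b hδ, hoff b a (Ne.symm hδ)]; simp
  · have := (key i j hij hδ).2
    rw [hs.1, hs.2] at this
    linarith [hNpos i, hNpos j]

theorem SO.diag_entry_of_diagonal {p : ℕ} (S : SO p) (h : ∀ i j, i ≠ j → S.1 i j = 0)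
    (i : Fin p) : S.1 i i = 1 ∨ S.1 i i = -1 := by
  have h1 := congrFun (congrFun (SO.mul_transpose S) i) i
  rw [Matrix.mul_apply, Finset.sum_eq_single i (fun j _ hj => by rw [h i j hj.symm, zero_mul])
    (fun hi => absurd (Finset.mem_univ i) hi), Matrix.transpose_apply, Matrix.one_apply_eq] at h1
  exact mul_self_eq_one_iff.1 h1

/-- A diagonal element of `SO(p)` other than the identity has at least two diagonal entries `-1`;
so the maximizer in `exists_mul_diagonal_of_planeRotation_mem` is the identity. -/
theorem smoothlyReachable_eq_top (p : ℕ) : smoothlyReachable p = ⊤ := by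
  refine eq_top_iff.2 fun R _ => ?_
  obtain ⟨h, hh, hoff, hneg⟩ := exists_mul_diagonal_of_planeRotation_mem (smoothlyReachable p)
    (isClosed_smoothlyReachable p) (fun _ => 1)
    (fun i j hij _ θ => planeRotation_mem_smoothlyReachable hij θ) R
    (fun h _ => by simp)
  have hdiag := SO.diag_entry_of_diagonal _ hoff
  have hS : (h * R).1 = Matrix.diagonal fun i => (h * R).1 i i := by
    ext i j
    rcases eq_or_ne i j with rfl | hij
    · simp
    · rw [Matrix.diagonal_apply_ne _ hij, hoff i j hij]
  have hdet : ∏ i, (h * R).1 i i = 1 := by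
    rw [← Matrix.det_diagonal, ← hS]
    exact (Matrix.mem_specialOrthogonalGroup_iff.1 (h * R).2).2
  have hone : ∀ i, (h * R).1 i i = 1 := by
    intro i
    refine (hdiag i).resolve_right fun hi => ?_
    rw [Finset.prod_eq_single i (fun j _ hj => (hdiag j).resolve_right fun hj' =>
      hneg i j hj.symm rfl ⟨hi, hj'⟩) (fun hi => absurd (Finset.mem_univ i) hi), hi] at hdet
    norm_num at hdet
  have h1 : h * R = 1 := by
    apply Subtype.ext
    rw [hS]
    simp only [hone, Matrix.diagonal_one]
    rfl
  rw [eq_inv_of_mul_eq_one_right h1]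
  exact inv_mem hh

theorem exists_curve {p : ℕ} (U V : SO p) :
    ∃ c : unitInterval → SO p, IsPiecewiseSmoothSO c ∧ c 0 = U ∧ c 1 = V :=
  exists_curve_of_mem_smoothlyReachable (by rw [smoothlyReachable_eq_top]; trivial)

/-! ### Identity components of stabilizers -/

theorem DiagPos.eq_diagonal {p : ℕ} (D : DiagPos p) :
    D.1 = Matrix.diagonal fun i => D.1 i i :=
  D.2.1.diagonal_diag.symm

theorem mem_stab_iff {p : ℕ} {D : DiagPos p} {R : SO p} : R ∈ stab D ↔ R.1 * D.1 = D.1 * R.1 := by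
  change R.1 * D.1 * R.1ᵀ = D.1 ↔ _
  constructor
  · intro h
    have := congrArg (fun A => A * R.1) h
    simpa only [Matrix.mul_assoc, SO.transpose_mul, Matrix.mul_one] using this
  · intro h
    rw [h, Matrix.mul_assoc, SO.mul_transpose, Matrix.mul_one]

theorem stab0_le_stab {p : ℕ} (D : DiagPos p) : stab0 D ≤ stab D := by
  rintro _ ⟨R, -, rfl⟩
  exact R.2

theorem isClosed_stab0 {p : ℕ} (D : DiagPos p) : IsClosed (stab0 D : Set (SO p)) := by
  have h1 : IsClosed (stab D : Set (SO p)) := by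
    have h : IsClosed {R : SO p | R.1 * D.1 = D.1 * R.1} :=
      isClosed_eq (continuous_subtype_val.matrix_mul continuous_const)
        (continuous_const.matrix_mul continuous_subtype_val)
    convert h using 1
    ext R
    exact mem_stab_iff
  exact h1.isClosedEmbedding_subtypeVal.isClosedMap _ isClosed_connectedComponent

theorem planeRotation_mem_stab0 {p : ℕ} (D : DiagPos p) {i j : Fin p} (hij : i ≠ j)
    (hD : D.1 i i = D.1 j j) (θ : ℝ) : planeRotation hij θ ∈ stab0 D := by
  have hgen : Commute (planeGenerator i j) D.1 := by
    rw [DiagPos.eq_diagonal D, commute_iff_eq]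
    ext a b
    rw [Matrix.mul_diagonal, Matrix.diagonal_mul]
    simp only [planeGenerator, Matrix.sub_apply, Matrix.single_apply]
    split_ifs with h1 h2 h2 <;> simp_all
  have hmem : ∀ θ, planeRotation hij θ ∈ stab D := fun θ => mem_stab_iff.2
    (((Commute.one_left _).add_left (hgen.smul_left _)).add_left
      ((hgen.mul_left hgen).smul_left _)).eq
  have hc : Continuous fun θ => (⟨planeRotation hij θ, hmem θ⟩ : stab D) :=
    (continuous_planeRotation hij).subtype_mk _
  have hsub := (isPreconnected_range hc).subset_connectedComponent
    (x := 1) ⟨0, Subtype.ext (planeRotation_zero hij)⟩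
  exact ⟨⟨planeRotation hij θ, hmem θ⟩, hsub ⟨θ, rfl⟩, rfl⟩

/-- `G_D` is the product of its identity component and the even sign changes. -/
theorem exists_stab0_mul_mem_evenSignedPerm {p : ℕ} {D : DiagPos p} {R : SO p}
    (hR : R ∈ stab D) : ∃ h ∈ stab0 D, h * R ∈ evenSignedPerm p := by
  obtain ⟨h, hh, hoff, -⟩ := exists_mul_diagonal_of_planeRotation_mem (stab0 D) (isClosed_stab0 D)
    (fun i => D.1 i i) (fun i j hij hD θ => planeRotation_mem_stab0 D hij hD θ) R
    (fun h hh => by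
      rw [← DiagPos.eq_diagonal D]
      exact mem_stab_iff.1 (mul_mem (stab0_le_stab D hh) hR))
  refine ⟨h, hh, fun i j => ?_⟩
  rcases eq_or_ne i j with rfl | hij
  · exact Or.inr (SO.diag_entry_of_diagonal _ hoff i)
  · exact Or.inl (hoff i j hij)

/-! ### Continuity of the geodesic distance of `SO(p)` -/

theorem le_distSO {p : ℕ} {U V : SO p} {b : ℝ} (h : ∀ c : unitInterval → SO p,
    IsPiecewiseSmoothSO c → c 0 = U → c 1 = V → b ≤ lengthSO c) : b ≤ distSO U V := by
  obtain ⟨c, hc, h0, h1⟩ := exists_curve U V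
  refine le_csInf ⟨_, c, hc, h0, h1, rfl⟩ ?_
  rintro l ⟨c, hc, h0, h1, rfl⟩
  exact h c hc h0 h1

theorem exists_lengthSO_lt {p : ℕ} (U V : SO p) {ε : ℝ} (hε : 0 < ε) :
    ∃ c : unitInterval → SO p, IsPiecewiseSmoothSO c ∧ c 0 = U ∧ c 1 = V ∧
      lengthSO c < distSO U V + ε := by
  by_contra! h
  have := le_distSO h
  linarith

theorem distSO_mul_expSO_le {p : ℕ} (U W : SO p) {A : Matrix (Fin p) (Fin p) ℝ} (hA : Aᵀ = -A) :
    distSO U (W * expSO A hA 1) ≤ distSO U W + √(1 / 2) * ‖A‖ := by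
  rw [← sub_le_iff_le_add]
  refine le_distSO fun c hc h0 h1 => ?_
  obtain ⟨c', hc', h0', h1', hl⟩ := exists_curve_mul_expSO hc hA
  rw [sub_le_iff_le_add]
  exact (distSO_le_lengthSO hc' (h0'.trans h0) (h1'.trans (by rw [h1]))).trans hl

theorem expSO_mul_neg {p : ℕ} {A : Matrix (Fin p) (Fin p) ℝ} (hA : Aᵀ = -A) :
    expSO A hA 1 * expSO (-A) (by rw [Matrix.transpose_neg, hA]) 1 = 1 := by
  apply Subtype.ext
  simp only [expSO, one_smul, Submonoid.coe_mul, Submonoid.coe_one]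
  rw [← Matrix.exp_add_of_commute A (-A) (Commute.refl A).neg_right, add_neg_cancel,
    NormedSpace.exp_zero]

theorem continuous_distSO_one (p : ℕ) : Continuous fun W : SO p => distSO 1 W := by
  rw [continuous_iff_continuousAt]
  intro W
  rw [ContinuousAt, Metric.tendsto_nhds]
  intro ε hε
  have ht : Filter.Tendsto (fun W' : SO p => W⁻¹ * W') (nhds W) (nhds 1) := by
    have : Continuous fun W' : SO p => W⁻¹ * W' := continuous_const.mul continuous_id
    simpa using this.tendsto W
  filter_upwards [ht.eventually (eventually_eq_expSO hε)] with W' hW'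
  obtain ⟨A, hA, hn, he⟩ := hW'
  have e1 : W' = W * expSO A hA 1 := by rw [← he, mul_inv_cancel_left]
  have e2 : W = W' * expSO (-A) (by rw [Matrix.transpose_neg, hA]) 1 := by
    rw [e1, mul_assoc, expSO_mul_neg, mul_one]
  have h1 := distSO_mul_expSO_le 1 W hA
  have h2 := distSO_mul_expSO_le 1 W' (A := -A) (by rw [Matrix.transpose_neg, hA])
  rw [← e1] at h1
  rw [← e2, norm_neg] at h2
  have h3 : √(1 / 2) * ‖A‖ ≤ ‖A‖ :=
    mul_le_of_le_one_left (norm_nonneg _) (Real.sqrt_le_one.2 (by norm_num))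
  rw [Real.dist_eq, abs_lt]
  constructor <;> linarith

theorem continuous_distSO (p : ℕ) : Continuous fun q : SO p × SO p => distSO q.1 q.2 := by
  have h : (fun q : SO p × SO p => distSO q.1 q.2) = fun q => distSO 1 (q.1⁻¹ * q.2) :=
    funext fun q => distSO_eq_one q.1 q.2
  rw [h]
  exact (continuous_distSO_one p).comp (continuous_fst.inv.mul continuous_snd)

/-! ### The metric of `Diag⁺(p)` in logarithmic coordinates -/

/-- The diagonal matrix with given diagonal, as a continuous linear map. -/
noncomputable def diagonalCLM (p : ℕ) : (Fin p → ℝ) →L[ℝ] Matrix (Fin p) (Fin p) ℝ :=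
  (Matrix.diagonalLinearMap (Fin p) ℝ ℝ).toContinuousLinearMap

/-- The diagonal of a matrix, as a continuous linear map. -/
noncomputable def diagCLM (p : ℕ) : Matrix (Fin p) (Fin p) ℝ →L[ℝ] (Fin p → ℝ) :=
  (Matrix.diagLinearMap (Fin p) ℝ ℝ).toContinuousLinearMap

theorem frobenius_norm_diagonal_sq {p : ℕ} (v : Fin p → ℝ) :
    ‖Matrix.diagonal v‖ ^ 2 = ∑ i, v i ^ 2 := by
  rw [frobenius_norm_sq]
  refine Finset.sum_congr rfl fun i _ => ?_
  rw [Finset.sum_eq_single i (fun j _ hj => by rw [Matrix.diagonal_apply_ne _ hj.symm]; simp)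
    (fun h => absurd (Finset.mem_univ i) h), Matrix.diagonal_apply_eq]

theorem DiagPos.inv_eq_diagonal {p : ℕ} (D : DiagPos p) :
    (D.1)⁻¹ = Matrix.diagonal fun i => (D.1 i i)⁻¹ := by
  refine Matrix.inv_eq_left_inv ?_
  nth_rewrite 2 [DiagPos.eq_diagonal D]
  rw [Matrix.diagonal_mul_diagonal, ← Matrix.diagonal_one]
  congr 1
  funext i
  exact inv_mul_cancel₀ (D.2.2 i).ne'

theorem metricDiag_diagonal {p : ℕ} (D : DiagPos p) (v : Fin p → ℝ) :
    metricDiag D (Matrix.diagonal v) (Matrix.diagonal v) =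
      ‖Matrix.diagonal fun i => v i / D.1 i i‖ ^ 2 := by
  rw [metricDiag, DiagPos.inv_eq_diagonal, frobenius_norm_diagonal_sq]
  simp only [Matrix.diagonal_mul_diagonal, Matrix.trace_diagonal]
  refine Finset.sum_congr rfl fun i _ => ?_
  ring

theorem hasDerivAt_diagLog {p : ℕ} {δ : ℝ → DiagPos p} {L : Matrix (Fin p) (Fin p) ℝ} {t : ℝ}
    (h : HasDerivAt (fun s => (δ s).1) L t) :
    HasDerivAt (fun s => diagLog (δ s).1)
      (Matrix.diagonal fun i => L i i / (δ t).1 i i) t := by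
  have h1 : HasDerivAt (fun s => diagCLM p (δ s).1) (diagCLM p L) t :=
    (diagCLM p).hasFDerivAt.comp_hasDerivAt t h
  have h2 : HasDerivAt (fun s => fun i => Real.log ((δ s).1 i i))
      (fun i => L i i / (δ t).1 i i) t :=
    hasDerivAt_pi.2 fun i => (hasDerivAt_pi.1 h1 i).log ((δ t).2.2 i).ne'
  exact (diagonalCLM p).hasFDerivAt.comp_hasDerivAt t h2

/-- In the coordinates `log D` the metric of `Diag⁺(p)` is Euclidean. -/
theorem metricDiag_deriv {p : ℕ} {δ : ℝ → DiagPos p} {t : ℝ}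
    (h : DifferentiableAt ℝ (fun s => (δ s).1) t) :
    metricDiag (δ t) (deriv (fun s => (δ s).1) t) (deriv (fun s => (δ s).1) t) =
      ‖deriv (fun s => diagLog (δ s).1) t‖ ^ 2 := by
  have h1 : HasDerivAt (fun s => (δ s).1) (deriv (fun s => (δ s).1) t) t := h.hasDerivAt
  set L := deriv (fun s => (δ s).1) t with hL
  have h2 : HasDerivAt (fun s => (δ s).1) (Matrix.diagonal fun i => L i i) t := by
    have h3 := ((diagonalCLM p).comp (diagCLM p)).hasFDerivAt.comp_hasDerivAt t h1
    refine h3.congr_of_eventuallyEq (Filter.Eventually.of_forall fun s => ?_)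
    exact DiagPos.eq_diagonal (δ s)
  have h4 : L = Matrix.diagonal fun i => L i i := h1.unique h2
  have h5 : deriv (fun s => diagLog (δ s).1) t =
      Matrix.diagonal fun i => L i i / (δ t).1 i i := (hasDerivAt_diagLog h1).deriv
  rw [h5]
  nth_rewrite 1 2 [h4]
  exact metricDiag_diagonal _ _

theorem contDiffOn_diagLog {p : ℕ} {δ : ℝ → DiagPos p} {s : Set ℝ}
    (h : ContDiffOn ℝ ∞ (fun t => (δ t).1) s) :
    ContDiffOn ℝ ∞ (fun t => diagLog (δ t).1) s := by
  have h1 : ContDiffOn ℝ ∞ (fun t => diagCLM p (δ t).1) s := (diagCLM p).contDiff.comp_contDiffOn h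
  have h2 : ContDiffOn ℝ ∞ (fun t => fun i => Real.log ((δ t).1 i i)) s :=
    contDiffOn_pi.2 fun i => (contDiffOn_pi.1 h1 i).log fun t _ => ((δ t).2.2 i).ne'
  exact (diagonalCLM p).contDiff.comp_contDiffOn h2

theorem logRatioNorm_eq {p : ℕ} (D Λ : DiagPos p) :
    logRatioNorm D Λ = ‖diagLog Λ.1 - diagLog D.1‖ := by
  rw [logRatioNorm, diagLog, diagLog, diagLog, Matrix.diagonal_sub]
  congr 2
  funext i
  rw [DiagPos.inv_eq_diagonal, Matrix.diagonal_mul,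
    Real.log_mul (inv_ne_zero (D.2.2 i).ne') (Λ.2.2 i).ne', Real.log_inv]
  ring

/-- The geodesic from `D` to `Λ` in `Diag⁺(p)`: logarithms of the entries are interpolated
linearly. -/
noncomputable def diagGeodesic {p : ℕ} (D Λ : DiagPos p) (x : ℝ) : DiagPos p :=
  ⟨Matrix.diagonal fun i =>
      Real.exp (Real.log (D.1 i i) + x * (Real.log (Λ.1 i i) - Real.log (D.1 i i))),
    Matrix.isDiag_diagonal _, fun i => by
      rw [Matrix.diagonal_apply_eq]
      exact Real.exp_pos _⟩

theorem diagGeodesic_zero {p : ℕ} (D Λ : DiagPos p) : diagGeodesic D Λ 0 = D := by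
  apply Subtype.ext
  rw [DiagPos.eq_diagonal D, diagGeodesic]
  simp only [zero_mul, add_zero, Real.exp_log (D.2.2 _)]

theorem diagGeodesic_one {p : ℕ} (D Λ : DiagPos p) : diagGeodesic D Λ 1 = Λ := by
  apply Subtype.ext
  rw [DiagPos.eq_diagonal Λ, diagGeodesic]
  simp only [one_mul, add_sub_cancel, Real.exp_log (Λ.2.2 _)]

theorem diagLog_diagGeodesic {p : ℕ} (D Λ : DiagPos p) (x : ℝ) :
    diagLog (diagGeodesic D Λ x).1 = diagLog D.1 + x • (diagLog Λ.1 - diagLog D.1) := by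
  rw [diagLog, diagLog, diagLog, Matrix.diagonal_sub, ← Matrix.diagonal_smul, Matrix.diagonal_add]
  congr 1
  funext i
  have h : (diagGeodesic D Λ x).1 i i =
      Real.exp (Real.log (D.1 i i) + x * (Real.log (Λ.1 i i) - Real.log (D.1 i i))) :=
    Matrix.diagonal_apply_eq _ _
  rw [h, Real.log_exp]
  rfl

theorem contDiff_diagGeodesic {p : ℕ} (D Λ : DiagPos p) :
    ContDiff ℝ ∞ fun x => (diagGeodesic D Λ x).1 :=
  (diagonalCLM p).contDiff.comp (contDiff_pi.2 fun _ =>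
    (contDiff_const.add (contDiff_id.mul contDiff_const)).exp)

/-! ### The geodesic distance of `M(p)` -/

/-- The speed of a curve in `M(p)` in terms of the Frobenius norms of the velocities of its rotation
part and of the logarithm of its scaling part. -/
theorem speedM_eq {p : ℕ} (k : ℝ) {γ : unitInterval → M p} {t : ℝ}
    (h : DifferentiableAt ℝ (fun s => (extend γ s).2.1) t) :
    speedM k γ t = √(k * (1 / 2 * ‖deriv (fun s => (extend γ s).1.1) t‖ ^ 2) +
      ‖deriv (fun s => diagLog (extend γ s).2.1) t‖ ^ 2) := by
  rw [speedM, metricSO_deriv (fun s => (extend γ s).1) t,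
    metricDiag_deriv (δ := fun s => (extend γ s).2) h]

theorem IsPiecewiseSmoothM.rotation {p : ℕ} {γ : unitInterval → M p} (h : IsPiecewiseSmoothM γ) :
    IsPiecewiseSmooth fun s => (extend γ s).1.1 :=
  IsPiecewiseSmooth.transfer h fun _ _ _ _ _ h => h.fst

theorem IsPiecewiseSmoothM.scaling {p : ℕ} {γ : unitInterval → M p} (h : IsPiecewiseSmoothM γ) :
    IsPiecewiseSmooth fun s => (extend γ s).2.1 :=
  IsPiecewiseSmooth.transfer h fun _ _ _ _ _ h => h.snd

theorem IsPiecewiseSmoothM.diagLog {p : ℕ} {γ : unitInterval → M p} (h : IsPiecewiseSmoothM γ) :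
    IsPiecewiseSmooth fun s => diagLog (extend γ s).2.1 :=
  h.scaling.transfer fun _ _ _ _ _ h => contDiffOn_diagLog h

theorem lengthM_nonneg {p : ℕ} (k : ℝ) (γ : unitInterval → M p) : 0 ≤ lengthM k γ :=
  intervalIntegral.integral_nonneg zero_le_one fun _ _ => Real.sqrt_nonneg _

/-- The length of a curve is at least the Euclidean length of the hypotenuse formed by the distances
of the end points of its components: pair the velocity with that vector and apply the
Cauchy–Schwarz inequality. -/
theorem sqrt_le_lengthM {p : ℕ} {k : ℝ} (hk : 0 < k) {γ : unitInterval → M p}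
    (hγ : IsPiecewiseSmoothM γ) :
    √(k * distSO (γ 0).1 (γ 1).1 ^ 2 + logRatioNorm (γ 0).2 (γ 1).2 ^ 2) ≤ lengthM k γ := by
  set A := distSO (γ 0).1 (γ 1).1 with hAdef
  set B := logRatioNorm (γ 0).2 (γ 1).2 with hBdef
  set a : ℝ → ℝ := fun t => √(1 / 2) * ‖deriv (fun s => (extend γ s).1.1) t‖ with ha
  set b : ℝ → ℝ := fun t => ‖deriv (fun s => diagLog (extend γ s).2.1) t‖ with hb
  have hA0 : 0 ≤ A := distSO_nonneg _ _
  have hB0 : 0 ≤ B := norm_nonneg _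
  have hai : IntervalIntegrable a volume 0 1 :=
    hγ.rotation.intervalIntegrable_norm_deriv.const_mul _
  have hbi : IntervalIntegrable b volume 0 1 := hγ.diagLog.intervalIntegrable_norm_deriv
  have hAa : A ≤ ∫ t in (0 : ℝ)..1, a t := by
    have h := distSO_le_lengthSO (c := fun t => (γ t).1) (U := (γ 0).1) (V := (γ 1).1)
      hγ.rotation rfl rfl
    rw [lengthSO_eq] at h
    exact h
  have hBb : B ≤ ∫ t in (0 : ℝ)..1, b t := by
    have h := hγ.diagLog.norm_sub_le_integral
    simp only [extend_zero, extend_one] at h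
    rw [hBdef, logRatioNorm_eq]
    exact h
  have hmeas : Measurable fun t => √(k * a t ^ 2 + b t ^ 2) := by
    have h1 : Measurable a :=
      ((stronglyMeasurable_deriv fun s => (extend γ s).1.1).norm.measurable).const_mul _
    have h2 : Measurable b :=
      (stronglyMeasurable_deriv fun s => diagLog (extend γ s).2.1).norm.measurable
    exact (((h1.pow_const 2).const_mul k).add (h2.pow_const 2)).sqrt
  have ha0 : ∀ t, 0 ≤ a t := fun t => mul_nonneg (Real.sqrt_nonneg _) (norm_nonneg _)
  have hb0 : ∀ t, 0 ≤ b t := fun t => norm_nonneg _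
  have hsi : IntervalIntegrable (fun t => √(k * a t ^ 2 + b t ^ 2)) volume 0 1 := by
    refine ((hai.const_mul √k).add hbi).mono_fun' hmeas.aestronglyMeasurable
      (Filter.Eventually.of_forall fun t => ?_)
    have h1 : 0 ≤ √k * a t := mul_nonneg (Real.sqrt_nonneg _) (ha0 t)
    simp only [Real.norm_eq_abs, abs_of_nonneg (Real.sqrt_nonneg _)]
    refine Real.sqrt_le_iff.2 ⟨add_nonneg h1 (hb0 t), ?_⟩
    nlinarith [Real.sq_sqrt hk.le, mul_nonneg h1 (hb0 t)]
  have hlen : lengthM k γ = ∫ t in (0 : ℝ)..1, √(k * a t ^ 2 + b t ^ 2) := by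
    obtain ⟨s, hs, C, hC⟩ := hγ.scaling.exists_deriv_bound
    rw [lengthM, intervalIntegral.integral_of_le zero_le_one,
      intervalIntegral.integral_of_le zero_le_one]
    refine integral_congr_ae ?_
    filter_upwards [ae_mem_Ioo_diff hs] with t ht
    rw [speedM_eq k ((hC t ht).1.differentiableAt (by simp))]
    simp only [ha, hb]
    rw [mul_pow, Real.sq_sqrt (by norm_num)]
  set E := k * A ^ 2 + B ^ 2 with hE
  have hE0 : 0 ≤ E := by positivity
  have hint : k * A * (∫ t in (0 : ℝ)..1, a t) + B * (∫ t in (0 : ℝ)..1, b t) ≤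
      √E * lengthM k γ := by
    rw [hlen, ← intervalIntegral.integral_const_mul, ← intervalIntegral.integral_const_mul,
      ← intervalIntegral.integral_const_mul,
      ← intervalIntegral.integral_add (hai.const_mul _) (hbi.const_mul _)]
    refine intervalIntegral.integral_mono_on zero_le_one
      ((hai.const_mul _).add (hbi.const_mul _)) (hsi.const_mul _) fun t _ => ?_
    rw [← Real.sqrt_mul hE0]
    refine Real.le_sqrt_of_sq_le ?_
    rw [hE]
    nlinarith [mul_nonneg hk.le (sq_nonneg (A * b t - B * a t))]
  have hEle : √E * √E ≤ √E * lengthM k γ := by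
    rw [Real.mul_self_sqrt hE0]
    refine le_trans ?_ hint
    have h1 : k * A * A ≤ k * A * ∫ t in (0 : ℝ)..1, a t :=
      mul_le_mul_of_nonneg_left hAa (by positivity)
    have h2 : B * B ≤ B * ∫ t in (0 : ℝ)..1, b t := mul_le_mul_of_nonneg_left hBb hB0
    rw [hE]
    linarith
  rcases (Real.sqrt_nonneg E).eq_or_lt with h0 | h0
  · rw [← h0]
    exact lengthM_nonneg k γ
  · exact le_of_mul_le_mul_left hEle h0

/-- A regularized speed that is a smooth function of the velocity also where that vanishes. -/
noncomputable def regularizedSpeed {p : ℕ} (ε : ℝ) (W : Matrix (Fin p) (Fin p) ℝ) : ℝ :=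
  √(1 / 2 * ‖W‖ ^ 2 + ε ^ 2)

theorem contDiff_regularizedSpeed {p : ℕ} {ε : ℝ} (hε : 0 < ε) :
    ContDiff ℝ ∞ (regularizedSpeed (p := p) ε) := by
  have h : ContDiff ℝ ∞ fun W : Matrix (Fin p) (Fin p) ℝ => ‖W‖ ^ 2 := by
    have h1 : (fun W : Matrix (Fin p) (Fin p) ℝ => ‖W‖ ^ 2) = fun W => ∑ i, ∑ j, W i j ^ 2 :=
      funext frobenius_norm_sq
    rw [h1]
    refine ContDiff.sum fun i _ => ContDiff.sum fun j _ => ContDiff.pow ?_ 2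
    exact (Matrix.entryLinearMap ℝ ℝ i j).toContinuousLinearMap.contDiff
  exact ((contDiff_const.mul h).add contDiff_const).sqrt fun W => by positivity

theorem regularizedSpeed_le {p : ℕ} {ε : ℝ} (hε : 0 < ε) (W : Matrix (Fin p) (Fin p) ℝ) :
    regularizedSpeed ε W ≤ √(1 / 2) * ‖W‖ + ε := by
  have h1 : 0 ≤ √(1 / 2) * ‖W‖ := by positivity
  refine Real.sqrt_le_iff.2 ⟨by positivity, ?_⟩
  have h2 : √(1 / 2 : ℝ) ^ 2 = 1 / 2 := Real.sq_sqrt (by norm_num)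
  nlinarith [mul_nonneg h1 hε.le]

theorem le_regularizedSpeed {p : ℕ} (ε : ℝ) (W : Matrix (Fin p) (Fin p) ℝ) :
    ε ≤ regularizedSpeed ε W :=
  Real.le_sqrt_of_sq_le (by nlinarith [sq_nonneg ‖W‖])

/-- Letting the scaling part run along its geodesic in proportion to the regularized arc length of a
curve `c` in `SO(p)` yields a curve in `M(p)` that is not much longer than the hypotenuse. -/
theorem exists_curve_lengthM_le {p : ℕ} {k : ℝ} (hk : 0 < k) {c : unitInterval → SO p}
    (hc : IsPiecewiseSmoothSO c) (D Λ : DiagPos p) {ε : ℝ} (hε : 0 < ε) :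
    ∃ γ : unitInterval → M p, IsPiecewiseSmoothM γ ∧ γ 0 = (c 0, D) ∧ γ 1 = (c 1, Λ) ∧
      lengthM k γ ≤ √(k * (lengthSO c + ε) ^ 2 + logRatioNorm D Λ ^ 2) := by
  have hc' : IsPiecewiseSmooth fun s => (extend c s).1 := hc
  set v : ℝ → Matrix (Fin p) (Fin p) ℝ := deriv fun s => (extend c s).1 with hv
  set φ : ℝ → ℝ := fun t => regularizedSpeed ε (v t) with hφ
  have hφi : IntervalIntegrable φ volume 0 1 :=
    hc'.intervalIntegrable_comp_deriv (contDiff_regularizedSpeed hε).continuous fun C =>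
      ⟨√(1 / 2) * C + ε, fun W hW => by
        have h0 : 0 ≤ regularizedSpeed ε W := Real.sqrt_nonneg _
        rw [abs_of_nonneg h0]
        refine (regularizedSpeed_le hε W).trans ?_
        gcongr⟩
  have hvi : IntervalIntegrable (fun t => √(1 / 2) * ‖v t‖) volume 0 1 :=
    hc'.intervalIntegrable_norm_deriv.const_mul _
  set S := ∫ t in (0 : ℝ)..1, φ t with hS
  have hSle : S ≤ lengthSO c + ε := by
    have h1 : S ≤ ∫ t in (0 : ℝ)..1, (√(1 / 2) * ‖v t‖ + ε) :=
      intervalIntegral.integral_mono_on zero_le_one hφi (hvi.add intervalIntegrable_const)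
        fun t _ => regularizedSpeed_le hε _
    rw [intervalIntegral.integral_add hvi intervalIntegrable_const] at h1
    rw [lengthSO_eq]
    simpa using h1
  have hSpos : 0 < S := by
    have h1 : ∫ t in (0 : ℝ)..1, ε ≤ S :=
      intervalIntegral.integral_mono_on zero_le_one intervalIntegrable_const hφi
        fun t _ => le_regularizedSpeed ε _
    have h2 : ∫ t in (0 : ℝ)..1, ε = ε := by simp
    linarith
  set σ : ℝ → ℝ := fun t => (∫ s in (0 : ℝ)..t, φ s) / S with hσ
  have hσ0 : σ 0 = 0 := by simp [hσ]
  have hσ1 : σ 1 = 1 := div_self hSpos.ne'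
  set γ : unitInterval → M p := fun t => (c t, diagGeodesic D Λ (σ t)) with hγ
  have hext2 : ∀ s ∈ Icc (0 : ℝ) 1, (extend γ s).2 = diagGeodesic D Λ (σ s) := by
    intro s hs
    rw [extend, IccExtend_of_mem _ _ hs]
  have hps : IsPiecewiseSmoothM γ := by
    refine IsPiecewiseSmooth.transfer hc fun a b ha hab hb h => ContDiffOn.prodMk h ?_
    have h1 : ContDiffOn ℝ ∞ σ (Icc a b) :=
      (contDiffOn_integral_comp_deriv (contDiff_regularizedSpeed hε) hφi ha hab hb h).div_const S
    exact ((contDiff_diagGeodesic D Λ).comp_contDiffOn h1).congr fun s hs =>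
      congrArg Subtype.val (hext2 s ⟨ha.trans hs.1, hs.2.trans hb⟩)
  set B := logRatioNorm D Λ with hB
  have hB0 : 0 ≤ B := norm_nonneg _
  have hspeed : ∀ᵐ t ∂(volume.restrict (Ioc (0 : ℝ) 1)),
      speedM k γ t ≤ √(k + B ^ 2 / S ^ 2) * φ t := by
    obtain ⟨s, hs, C, hC⟩ := hc'.exists_deriv_bound
    filter_upwards [ae_mem_Ioo_diff hs] with t ht
    have hσd : HasDerivAt σ (φ t / S) t :=
      (IsPiecewiseSmooth.hasDerivAt_integral_comp_deriv
        (contDiff_regularizedSpeed hε).continuous hφi ht.1 (hC t ht).1).div_const S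
    have hev : ∀ᶠ s in nhds t, (extend γ s).2 = diagGeodesic D Λ (σ s) := by
      filter_upwards [Icc_mem_nhds ht.1.1 ht.1.2] with s hs using hext2 s hs
    have hd1 : DifferentiableAt ℝ (fun s => (extend γ s).2.1) t := by
      have h1 : DifferentiableAt ℝ (fun s => (diagGeodesic D Λ (σ s)).1) t :=
        ((contDiff_diagGeodesic D Λ).differentiable (by simp) _).comp t hσd.differentiableAt
      exact h1.congr_of_eventuallyEq (hev.mono fun s hs => congrArg Subtype.val hs)
    have hd2 : HasDerivAt (fun s => diagLog (extend γ s).2.1)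
        ((φ t / S) • (diagLog Λ.1 - diagLog D.1)) t := by
      refine ((hσd.smul_const (diagLog Λ.1 - diagLog D.1)).const_add
        (diagLog D.1)).congr_of_eventuallyEq ?_
      filter_upwards [hev] with s hs
      rw [hs, diagLog_diagGeodesic]
    have hd3 : deriv (fun s => diagLog (extend γ s).2.1) t =
        (φ t / S) • (diagLog Λ.1 - diagLog D.1) := hd2.deriv
    have hφ0 : 0 ≤ φ t := Real.sqrt_nonneg _
    have hφsq : φ t ^ 2 = 1 / 2 * ‖v t‖ ^ 2 + ε ^ 2 := Real.sq_sqrt (by positivity)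
    rw [speedM_eq k hd1, hd3, norm_smul, ← logRatioNorm_eq, Real.norm_eq_abs, mul_pow, sq_abs]
    refine Real.sqrt_le_iff.2 ⟨by positivity, ?_⟩
    rw [mul_pow, Real.sq_sqrt (by positivity), div_pow, add_mul]
    refine add_le_add (mul_le_mul_of_nonneg_left ?_ hk.le) (le_of_eq ?_)
    · rw [hφsq]
      exact le_add_of_nonneg_right (sq_nonneg ε)
    · rw [← hB]; ring
  refine ⟨γ, hps, ?_, ?_, ?_⟩
  · simp only [hγ, Set.Icc.coe_zero, hσ0, diagGeodesic_zero]
  · simp only [hγ, Set.Icc.coe_one, hσ1, diagGeodesic_one]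
  have hle : lengthM k γ ≤ √(k + B ^ 2 / S ^ 2) * S := by
    rw [hS, ← intervalIntegral.integral_const_mul, lengthM,
      intervalIntegral.integral_of_le zero_le_one, intervalIntegral.integral_of_le zero_le_one]
    refine integral_mono_of_nonneg (Filter.Eventually.of_forall fun _ => Real.sqrt_nonneg _) ?_
      hspeed
    rw [← IntegrableOn, ← intervalIntegrable_iff_integrableOn_Ioc_of_le zero_le_one]
    exact hφi.const_mul _
  refine hle.trans (Real.le_sqrt_of_sq_le ?_)
  rw [mul_pow, Real.sq_sqrt (by positivity), add_mul, div_mul_cancel₀ _ (by positivity)]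
  gcongr

theorem bddBelow_lengthM {p : ℕ} (k : ℝ) (q₀ q₁ : M p) : BddBelow {l | ∃ γ : unitInterval → M p,
    IsPiecewiseSmoothM γ ∧ γ 0 = q₀ ∧ γ 1 = q₁ ∧ l = lengthM k γ} :=
  ⟨0, by rintro l ⟨γ, -, -, -, rfl⟩; exact lengthM_nonneg k γ⟩

/-- The Pythagorean formula for the geodesic distance of the Riemannian product `M(p)`. -/
theorem distM_eq_sqrt {p : ℕ} {k : ℝ} (hk : 0 < k) (q₀ q₁ : M p) :
    distM k q₀ q₁ = √(k * distSO q₀.1 q₁.1 ^ 2 + logRatioNorm q₀.2 q₁.2 ^ 2) := by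
  have hup : ∀ ε > 0, distM k q₀ q₁ ≤
      √(k * (distSO q₀.1 q₁.1 + ε + ε) ^ 2 + logRatioNorm q₀.2 q₁.2 ^ 2) := by
    intro ε hε
    obtain ⟨c, hc, h0, h1, hl⟩ := exists_lengthSO_lt q₀.1 q₁.1 hε
    obtain ⟨γ, hγ, g0, g1, hle⟩ := exists_curve_lengthM_le hk hc q₀.2 q₁.2 hε
    refine (csInf_le (bddBelow_lengthM k q₀ q₁) ⟨γ, hγ, ?_, ?_, rfl⟩).trans (hle.trans ?_)
    · rw [g0, h0]
    · rw [g1, h1]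
    · have := lengthSO_nonneg c
      gcongr
  apply le_antisymm
  · have ht : Filter.Tendsto (fun ε : ℝ => √(k * (distSO q₀.1 q₁.1 + ε + ε) ^ 2 +
        logRatioNorm q₀.2 q₁.2 ^ 2)) (nhdsWithin 0 (Ioi 0))
        (nhds √(k * distSO q₀.1 q₁.1 ^ 2 + logRatioNorm q₀.2 q₁.2 ^ 2)) := by
      have hcont : Continuous fun ε : ℝ => √(k * (distSO q₀.1 q₁.1 + ε + ε) ^ 2 +
        logRatioNorm q₀.2 q₁.2 ^ 2) := by fun_prop
      have := hcont.tendsto 0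
      simp only [add_zero] at this
      exact this.mono_left nhdsWithin_le_nhds
    exact ge_of_tendsto ht (Filter.eventually_of_mem self_mem_nhdsWithin hup)
  · obtain ⟨c, hc, h0, h1, -⟩ := exists_lengthSO_lt q₀.1 q₁.1 one_pos
    obtain ⟨γ, hγ, g0, g1, -⟩ := exists_curve_lengthM_le hk hc q₀.2 q₁.2 one_pos
    refine le_csInf ⟨_, γ, hγ, g0.trans (by rw [h0]), g1.trans (by rw [h1]), rfl⟩ ?_
    rintro l ⟨γ, hγ, rfl, rfl, rfl⟩
    exact sqrt_le_lengthM hk hγ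

/-! ### The action of signed permutations on diagonal matrices -/

theorem permAct_perm_mul {p : ℕ} (g : evenSignedPerm p) (D : DiagPos p) :
    (permAct (evenSignedPerm.perm g) D).1 * g.1.1 = g.1.1 * D.1 := by
  have hspec := (evenSignedPerm.exists_perm g).choose_spec
  ext j i
  rw [DiagPos.eq_diagonal D, DiagPos.eq_diagonal (permAct _ D), Matrix.diagonal_mul,
    Matrix.mul_diagonal]
  by_cases h : g.1.1 j i = 0
  · rw [h]; simp
  · have hj : j = evenSignedPerm.perm g i := (hspec i j).1 h
    have : (permAct (evenSignedPerm.perm g) D).1 j j = D.1 i i := by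
      rw [hj]
      simp [permAct]
    rw [this, mul_comm]

theorem eq_permAct_perm {p : ℕ} {g : evenSignedPerm p} {D D' : DiagPos p}
    (h : D'.1 * g.1.1 = g.1.1 * D.1) : D' = permAct (evenSignedPerm.perm g) D := by
  apply Subtype.ext
  rw [← permAct_perm_mul] at h
  have := congrArg (fun A => A * g.1.1ᵀ) h
  simpa only [Matrix.mul_assoc, SO.mul_transpose, Matrix.mul_one] using this

theorem permAct_perm_eq_conj {p : ℕ} (g : evenSignedPerm p) (D : DiagPos p) :
    (permAct (evenSignedPerm.perm g) D).1 = g.1.1 * D.1 * g.1.1ᵀ := by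
  rw [← permAct_perm_mul, Matrix.mul_assoc, SO.mul_transpose, Matrix.mul_one]

theorem permAct_perm_mul_apply {p : ℕ} (a b : evenSignedPerm p) (D : DiagPos p) :
    permAct (evenSignedPerm.perm (a * b)) D =
      permAct (evenSignedPerm.perm a) (permAct (evenSignedPerm.perm b) D) := by
  refine (eq_permAct_perm ?_).symm
  calc (permAct (evenSignedPerm.perm a) (permAct (evenSignedPerm.perm b) D)).1 * (a.1.1 * b.1.1)
      = (permAct (evenSignedPerm.perm a) (permAct (evenSignedPerm.perm b) D)).1 * a.1.1 * b.1.1 := by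
        rw [Matrix.mul_assoc]
    _ = a.1.1 * b.1.1 * D.1 := by
        rw [permAct_perm_mul, Matrix.mul_assoc, permAct_perm_mul, Matrix.mul_assoc]

theorem permAct_perm_of_mem_stab {p : ℕ} {g : evenSignedPerm p} {D : DiagPos p}
    (h : g.1 ∈ stab D) : permAct (evenSignedPerm.perm g) D = D :=
  (eq_permAct_perm (mem_stab_iff.1 h).symm).symm

theorem logRatioNorm_permAct {p : ℕ} (π : Equiv.Perm (Fin p)) (D Λ : DiagPos p) :
    logRatioNorm (permAct π D) (permAct π Λ) = logRatioNorm D Λ := by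
  rw [logRatioNorm_eq, logRatioNorm_eq, ← sq_eq_sq₀ (norm_nonneg _) (norm_nonneg _)]
  simp only [diagLog, Matrix.diagonal_sub, frobenius_norm_diagonal_sq]
  exact Equiv.sum_comp π.symm fun i => (Real.log (Λ.1 i i) - Real.log (D.1 i i)) ^ 2

instance evenSignedPerm.finite (p : ℕ) : Finite (evenSignedPerm p) := by
  have h : {f : Fin p → Fin p → ℝ |
      ∀ i, f i ∈ {v : Fin p → ℝ | ∀ j, v j ∈ ({0, 1, -1} : Set ℝ)}}.Finite :=
    Set.Finite.pi' fun _ => Set.Finite.pi' fun _ => Set.toFinite _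
  have : Finite {f : Fin p → Fin p → ℝ |
      ∀ i, f i ∈ {v : Fin p → ℝ | ∀ j, v j ∈ ({0, 1, -1} : Set ℝ)}} := h
  refine Finite.of_injective (β := {f : Fin p → Fin p → ℝ |
      ∀ i, f i ∈ {v : Fin p → ℝ | ∀ j, v j ∈ ({0, 1, -1} : Set ℝ)}})
    (fun g => ⟨fun i j => g.1.1 i j, fun i j => g.2 i j⟩) fun a b hab => ?_
  apply Subtype.ext
  apply Subtype.ext
  ext i j
  exact congrFun (congrFun (congrArg Subtype.val hab) i) j

/-! ### The fibers of the eigen-composition map -/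

theorem mem_fiber_iff {p : ℕ} {X : SymPos p} {q : M p} :
    q ∈ fiber X ↔ q.1.1 * q.2.1 * q.1.1ᵀ = X.1 :=
  ⟨fun h => congrArg Subtype.val h, fun h => Subtype.ext h⟩

/-- Similar diagonal matrices have the same characteristic polynomial, hence the same diagonal up to
a permutation. -/
theorem exists_perm_of_mul_eq {p : ℕ} {W : SO p} {D D' : DiagPos p} (h : W.1 * D'.1 = D.1 * W.1) :
    ∃ σ : Equiv.Perm (Fin p), ∀ i, D.1 (σ i) (σ i) = D'.1 i i := by
  have hD : D'.1 = W.1ᵀ * (D.1 * W.1) := by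
    rw [← h, ← Matrix.mul_assoc, SO.transpose_mul, Matrix.one_mul]
  have hchar : D'.1.charpoly = D.1.charpoly := by
    rw [hD, Matrix.charpoly_mul_comm, Matrix.mul_assoc, SO.mul_transpose, Matrix.mul_one]
  have hroots : ∀ D : DiagPos p, D.1.charpoly.roots =
      (Finset.univ : Finset (Fin p)).val.map fun i => D.1 i i := by
    intro D
    nth_rewrite 1 [DiagPos.eq_diagonal D]
    rw [Matrix.charpoly_diagonal, Finset.prod,
      ← Polynomial.roots_multiset_prod_X_sub_C (Multiset.map (fun i => D.1 i i) _),
      Multiset.map_map]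
    rfl
  have hmul : (Finset.univ : Finset (Fin p)).val.map (fun i => D'.1 i i) =
      (Finset.univ : Finset (Fin p)).val.map fun i => D.1 i i := by
    rw [← hroots, ← hroots, hchar]
  have hcard : ∀ c, Nonempty ({i // D'.1 i i = c} ≃ {i // D.1 i i = c}) := by
    intro c
    refine Fintype.card_eq.1 ?_
    have := congrArg (Multiset.count c) hmul
    rw [Multiset.count_map, Multiset.count_map] at this
    rw [Fintype.card_subtype, Fintype.card_subtype]
    simpa only [Finset.card, Finset.filter, eq_comm] using this
  exact ⟨Equiv.ofFiberEquiv fun c => (hcard c).some, fun i =>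
    Equiv.ofFiberEquiv_map (f := fun i => D'.1 i i) (g := fun i => D.1 i i) _ i⟩

/-- A permutation of the diagonal entries is realized by an even signed permutation: the sign of one
column of the permutation matrix is adjusted. -/
theorem exists_evenSignedPerm_mul_eq {p : ℕ} (hp : 0 < p) {D D' : DiagPos p}
    (σ : Equiv.Perm (Fin p)) (hσ : ∀ i, D.1 (σ i) (σ i) = D'.1 i i) :
    ∃ g : evenSignedPerm p, D'.1 * g.1.1 = g.1.1 * D.1 := by
  -- the sign of the first column is chosen so that the determinant becomes `1`
  set ε : ℝ := ((Equiv.Perm.sign σ : ℤ) : ℝ) with hε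
  have hε2 : ε = 1 ∨ ε = -1 := by
    rcases Int.units_eq_one_or (Equiv.Perm.sign σ) with h | h <;> simp [hε, h]
  set s : Fin p → ℝ := fun i => if i = ⟨0, hp⟩ then ε else 1 with hs
  have hs1 : ∀ i, s i = 1 ∨ s i = -1 := by
    intro i
    simp only [hs]
    split_ifs
    · exact hε2
    · exact Or.inl rfl
  set P : Matrix (Fin p) (Fin p) ℝ := σ.permMatrix ℝ * Matrix.diagonal s with hP
  have hPapply : ∀ i j, P i j = (if σ i = j then 1 else 0) * s j := by
    intro i j
    rw [hP, Matrix.mul_diagonal]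
    congr 1
    refine (PEquiv.toMatrix_apply _ i j).trans ?_
    simp [Equiv.toPEquiv_apply, eq_comm]
  have hss : Matrix.diagonal s * Matrix.diagonal s = 1 := by
    rw [Matrix.diagonal_mul_diagonal, ← Matrix.diagonal_one]
    congr 1
    funext i
    rcases hs1 i with h | h <;> rw [h] <;> norm_num
  have hPP : P * Pᵀ = 1 := by
    rw [hP, Matrix.transpose_mul, Matrix.diagonal_transpose, Matrix.mul_assoc,
      ← Matrix.mul_assoc (Matrix.diagonal s), hss, Matrix.one_mul, Matrix.transpose_permMatrix,
      ← Matrix.permMatrix_mul, inv_mul_cancel, Matrix.permMatrix_one]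
  have hdet : P.det = 1 := by
    rw [hP, Matrix.det_mul, Matrix.det_diagonal, Matrix.det_permutation]
    simp only [hs, Finset.prod_ite_eq', Finset.mem_univ, if_true]
    change ε * ε = 1
    rcases hε2 with h | h <;> rw [h] <;> norm_num
  have hmem : P ∈ Matrix.specialOrthogonalGroup (Fin p) ℝ :=
    Matrix.mem_specialOrthogonalGroup_iff.2 ⟨(Matrix.mem_orthogonalGroup_iff _ _).2 hPP, hdet⟩
  refine ⟨⟨⟨P, hmem⟩, fun i j => ?_⟩, ?_⟩
  · change P i j = 0 ∨ P i j = 1 ∨ P i j = -1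
    rw [hPapply]
    split_ifs
    · rw [one_mul]; exact Or.inr (hs1 j)
    · rw [zero_mul]; exact Or.inl rfl
  · change D'.1 * P = P * D.1
    ext i j
    rw [DiagPos.eq_diagonal D, DiagPos.eq_diagonal D', Matrix.diagonal_mul, Matrix.mul_diagonal,
      hPapply, ← hσ]
    split_ifs with h
    · rw [h, mul_comm]
    · simp

/-- All eigen-decompositions of a matrix arise from a given one by elements of `G_D⁰` and even
signed permutations. -/
theorem exists_mul_eq_of_mem_fiber {p : ℕ} (hp : 0 < p) {X : SymPos p} {U U' : SO p}
    {D D' : DiagPos p} (h : (U, D) ∈ fiber X) (h' : (U', D') ∈ fiber X) :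
    ∃ (g : evenSignedPerm p) (R : SO p), R ∈ stab0 D ∧ U' * g.1 = U * R ∧
      D' = permAct (evenSignedPerm.perm g) D := by
  have e : U'.1 * D'.1 * U'.1ᵀ = U.1 * D.1 * U.1ᵀ :=
    (mem_fiber_iff.1 h').trans (mem_fiber_iff.1 h).symm
  have hW : (U⁻¹ * U').1 * D'.1 = D.1 * (U⁻¹ * U').1 := by
    have := congrArg (fun A => U.1ᵀ * (A * U'.1)) e
    simp only [Matrix.mul_assoc, SO.transpose_mul, Matrix.mul_one] at this
    simp only [← Matrix.mul_assoc, SO.transpose_mul, Matrix.one_mul] at this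
    rw [Submonoid.coe_mul, SO.coe_inv, this, Matrix.mul_assoc]
  obtain ⟨σ, hσ⟩ := exists_perm_of_mul_eq hW
  obtain ⟨g, hg⟩ := exists_evenSignedPerm_mul_eq hp σ hσ
  have hstab : U⁻¹ * U' * g.1 ∈ stab D := by
    rw [mem_stab_iff, Submonoid.coe_mul, Matrix.mul_assoc, ← hg, ← Matrix.mul_assoc, hW,
      Matrix.mul_assoc]
  obtain ⟨a, ha, hag⟩ := exists_stab0_mul_mem_evenSignedPerm hstab
  set b : evenSignedPerm p := ⟨a * (U⁻¹ * U' * g.1), hag⟩ with hb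
  have hbstab : b.1 ∈ stab D := mul_mem (stab0_le_stab D ha) hstab
  refine ⟨g * b⁻¹, a⁻¹, inv_mem ha, ?_, ?_⟩
  · rw [Subgroup.coe_mul, Subgroup.coe_inv]
    change U' * (g.1 * (a * (U⁻¹ * U' * g.1))⁻¹) = U * a⁻¹
    group
  · have hb' : (b⁻¹).1 ∈ stab D := inv_mem hbstab
    rw [permAct_perm_mul_apply, permAct_perm_of_mem_stab hb']
    exact eq_permAct_perm hg

theorem mul_mem_fiber {p : ℕ} {X : SymPos p} {U : SO p} {D : DiagPos p} (h : (U, D) ∈ fiber X)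
    (g : evenSignedPerm p) {R : SO p} (hR : R ∈ stab D) :
    (U * R * (g.1)⁻¹, permAct (evenSignedPerm.perm g) D) ∈ fiber X := by
  rw [mem_fiber_iff] at h ⊢
  have hR' : R.1 * D.1 * R.1ᵀ = D.1 := hR
  rw [← h, permAct_perm_eq_conj]
  nth_rewrite 2 [← hR']
  simp only [Submonoid.coe_mul, SO.coe_inv, Matrix.transpose_mul, Matrix.transpose_transpose,
    Matrix.mul_assoc]
  simp only [← Matrix.mul_assoc g.1.1ᵀ g.1.1, SO.transpose_mul, Matrix.one_mul]

/-! ### The distance formula -/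

theorem isLeast_minRotationDist {p : ℕ} (g : evenSignedPerm p) (q r : M p) :
    IsLeast (rotationDistances g q r) (minRotationDist g q r) := by
  have himg : rotationDistances g q r =
      (fun R : SO p × SO p => distSO (q.1 * R.1) (r.1 * R.2 * (g : SO p)⁻¹)) ''
        ((stab0 q.2 : Set (SO p)) ×ˢ (stab0 r.2 : Set (SO p))) := by
    ext l
    constructor
    · rintro ⟨R, hR, S, hS, rfl⟩
      exact ⟨(R, S), ⟨hR, hS⟩, rfl⟩
    · rintro ⟨⟨R, S⟩, ⟨hR, hS⟩, rfl⟩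
      exact ⟨R, hR, S, hS, rfl⟩
  have hcont : Continuous
      fun R : SO p × SO p => distSO (q.1 * R.1) (r.1 * R.2 * (g : SO p)⁻¹) :=
    (continuous_distSO p).comp ((continuous_const.mul continuous_fst).prodMk
      ((continuous_const.mul continuous_snd).mul continuous_const))
  refine IsCompact.isLeast_sInf ?_ ⟨_, 1, one_mem _, 1, one_mem _, rfl⟩
  rw [himg]
  exact ((isClosed_stab0 q.2).isCompact.prod (isClosed_stab0 r.2).isCompact).image hcont

/-- The expression `k d̂(g)² + ‖log (D⁻¹ (π_g · Λ))‖²` minimized in the distance formula. -/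
noncomputable def signedPermCost {p : ℕ} (k : ℝ) (q r : M p) (g : evenSignedPerm p) : ℝ :=
  k * minRotationDist g q r ^ 2 +
    logRatioNorm q.2 (permAct (evenSignedPerm.perm g) r.2) ^ 2

theorem minRotationDist_nonneg {p : ℕ} (g : evenSignedPerm p) (q r : M p) :
    0 ≤ minRotationDist g q r := by
  obtain ⟨R, -, S, -, h⟩ := (isLeast_minRotationDist g q r).1
  exact h ▸ distSO_nonneg _ _

theorem signedPermCost_nonneg {p : ℕ} {k : ℝ} (hk : 0 < k) (q r : M p) (g : evenSignedPerm p) :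
    0 ≤ signedPermCost k q r g := by
  unfold signedPermCost
  positivity

/-- Replacing `(R_U, R_V)` by `(R_U P_a⁻¹, R_V P_b)` turns the rotation distances for `g` into those
for `a g b`. -/
theorem signedPermCost_mul_mul_le {p : ℕ} {k : ℝ} (hk : 0 < k) (q r : M p)
    {a b : evenSignedPerm p} (ha : a ∈ Gamma0 q.2) (hb : b ∈ Gamma0 r.2) (g : evenSignedPerm p) :
    signedPermCost k q r (a * g * b) ≤ signedPermCost k q r g := by
  have ha' : a.1 ∈ stab0 q.2 := Subgroup.mem_subgroupOf.1 ha
  have hb' : b.1 ∈ stab0 r.2 := Subgroup.mem_subgroupOf.1 hb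
  have h1 : minRotationDist (a * g * b) q r ≤ minRotationDist g q r := by
    obtain ⟨R, hR, S, hS, h⟩ := (isLeast_minRotationDist g q r).1
    rw [h]
    refine (isLeast_minRotationDist (a * g * b) q r).2
      ⟨R * (a.1)⁻¹, mul_mem hR (inv_mem ha'), S * b.1, mul_mem hS hb', ?_⟩
    rw [← distSO_mul_mul 1 (a.1)⁻¹]
    congr 1
    · group
    · simp only [Subgroup.coe_mul]
      group
  have h2 : logRatioNorm q.2 (permAct (evenSignedPerm.perm (a * g * b)) r.2) =
      logRatioNorm q.2 (permAct (evenSignedPerm.perm g) r.2) := by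
    rw [permAct_perm_mul_apply, permAct_perm_of_mem_stab (stab0_le_stab _ hb'),
      permAct_perm_mul_apply]
    nth_rewrite 1 [← permAct_perm_of_mem_stab (stab0_le_stab _ ha')]
    exact logRatioNorm_permAct _ _ _
  have h0 := minRotationDist_nonneg (a * g * b) q r
  unfold signedPermCost
  rw [h2]
  gcongr

/-- Write `q₀` and `q₁` as translates by `a` and `b` of points of `[q]` and `[r]`; by invariance of the
metric only `g = a⁻¹ b` matters. -/
theorem exists_sqrt_signedPermCost_le_distM {p : ℕ} (hp : 0 < p) {k : ℝ} (hk : 0 < k)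
    {X Y : SymPos p} {q r q₀ q₁ : M p} (hq : q ∈ fiber X) (hr : r ∈ fiber Y)
    (hq₀ : q₀ ∈ fiber X) (hq₁ : q₁ ∈ fiber Y) :
    ∃ g, √(signedPermCost k q r g) ≤ distM k q₀ q₁ := by
  obtain ⟨a, R, hR, haR, ha⟩ := exists_mul_eq_of_mem_fiber hp hq hq₀
  obtain ⟨b, S, hS, hbS, hb⟩ := exists_mul_eq_of_mem_fiber hp hr hq₁
  refine ⟨a⁻¹ * b, ?_⟩
  have h1 : minRotationDist (a⁻¹ * b) q r ≤ distSO q₀.1 q₁.1 := by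
    refine (isLeast_minRotationDist (a⁻¹ * b) q r).2 ⟨R, hR, S, hS, ?_⟩
    rw [← haR, ← hbS, ← distSO_mul_mul 1 a.1]
    congr 1
    · group
    · simp only [Subgroup.coe_mul, Subgroup.coe_inv]
      group
  have h2 : logRatioNorm q₀.2 q₁.2 =
      logRatioNorm q.2 (permAct (evenSignedPerm.perm (a⁻¹ * b)) r.2) := by
    have hb' : q₁.2 = permAct (evenSignedPerm.perm a)
        (permAct (evenSignedPerm.perm (a⁻¹ * b)) r.2) := by
      rw [← permAct_perm_mul_apply, mul_inv_cancel_left]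
      exact hb
    rw [hb', show q₀.2 = _ from ha, logRatioNorm_permAct]
  have h0 := minRotationDist_nonneg (a⁻¹ * b) q r
  rw [distM_eq_sqrt hk, h2]
  unfold signedPermCost
  gcongr

theorem exists_distM_eq_sqrt_signedPermCost {p : ℕ} {k : ℝ} (hk : 0 < k) {X Y : SymPos p}
    {q r : M p} (hq : q ∈ fiber X) (hr : r ∈ fiber Y) (g : evenSignedPerm p) :
    ∃ q₀ ∈ fiber X, ∃ q₁ ∈ fiber Y, distM k q₀ q₁ = √(signedPermCost k q r g) := by
  obtain ⟨R, hR, S, hS, h⟩ := (isLeast_minRotationDist g q r).1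
  refine ⟨(q.1 * R, q.2), ?_, _, mul_mem_fiber hr g (stab0_le_stab _ hS), ?_⟩
  · rw [mem_fiber_iff] at hq ⊢
    have hR' : R.1 * q.2.1 * R.1ᵀ = q.2.1 := stab0_le_stab _ hR
    rw [← hq]
    nth_rewrite 2 [← hR']
    simp only [Submonoid.coe_mul, Matrix.transpose_mul, Matrix.mul_assoc]
  · rw [distM_eq_sqrt hk, signedPermCost, h]

theorem distSR_sq_eq {p : ℕ} (hp : 0 < p) {k : ℝ} (hk : 0 < k) {X Y : SymPos p}
    {q r : M p} (hq : q ∈ fiber X) (hr : r ∈ fiber Y) {g : evenSignedPerm p}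
    (hg : ∀ g', signedPermCost k q r g ≤ signedPermCost k q r g') :
    distSR k X Y ^ 2 = signedPermCost k q r g := by
  have hle : IsLeast {l | ∃ q₀ ∈ fiber X, ∃ q₁ ∈ fiber Y, l = distM k q₀ q₁}
      √(signedPermCost k q r g) := by
    constructor
    · obtain ⟨q₀, h₀, q₁, h₁, h⟩ := exists_distM_eq_sqrt_signedPermCost hk hq hr g
      exact ⟨q₀, h₀, q₁, h₁, h.symm⟩
    · rintro l ⟨q₀, h₀, q₁, h₁, rfl⟩
      obtain ⟨g', hg'⟩ := exists_sqrt_signedPermCost_le_distM hp hk hq hr h₀ h₁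
      exact (Real.sqrt_le_sqrt (hg g')).trans hg'
  rw [distSR, hle.csInf_eq, Real.sq_sqrt (signedPermCost_nonneg hk q r g)]

/-! ### The action of signed permutations on curves -/

/-- The action `(U, D) ↦ (U P_g, P_g⁻¹ D P_g)`, which preserves the metric of `M(p)` and the fibers
of `F`. -/
noncomputable def signedPermTranslate {p : ℕ} (g : evenSignedPerm p) (q : M p) : M p :=
  (q.1 * g.1, permAct (evenSignedPerm.perm g⁻¹) q.2)

theorem signedPermTranslate_scaling {p : ℕ} (g : evenSignedPerm p) (q : M p) :
    (signedPermTranslate g q).2.1 = (g.1⁻¹).1 * q.2.1 * g.1.1 := by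
  rw [signedPermTranslate, permAct_perm_eq_conj, Subgroup.coe_inv, SO.coe_inv,
    Matrix.transpose_transpose]

theorem F_signedPermTranslate {p : ℕ} (g : evenSignedPerm p) (q : M p) :
    F (signedPermTranslate g q) = F q := by
  apply Subtype.ext
  change (q.1 * g.1).1 * (signedPermTranslate g q).2.1 * (q.1 * g.1).1ᵀ = q.1.1 * q.2.1 * q.1.1ᵀ
  rw [signedPermTranslate_scaling, SO.coe_inv, Submonoid.coe_mul, Matrix.transpose_mul]
  simp only [Matrix.mul_assoc]
  simp only [← Matrix.mul_assoc g.1.1 g.1.1ᵀ, SO.mul_transpose, Matrix.one_mul]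

theorem metricDiag_conj {p : ℕ} (g : SO p) {D D' : DiagPos p}
    (h : D'.1 = (g⁻¹).1 * D.1 * g.1) (L : Matrix (Fin p) (Fin p) ℝ) :
    metricDiag D' ((g⁻¹).1 * L * g.1) ((g⁻¹).1 * L * g.1) = metricDiag D L L := by
  have hinv : (D'.1)⁻¹ = g.1ᵀ * (D.1)⁻¹ * g.1 := by
    have hdet : IsUnit D.1.det := by
      rw [DiagPos.eq_diagonal D, Matrix.det_diagonal]
      exact (Finset.prod_pos fun i _ => D.2.2 i).ne'.isUnit
    refine Matrix.inv_eq_left_inv ?_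
    rw [h, SO.coe_inv]
    simp only [Matrix.mul_assoc]
    rw [← Matrix.mul_assoc g.1 g.1ᵀ, SO.mul_transpose, Matrix.one_mul,
      ← Matrix.mul_assoc (D.1)⁻¹, Matrix.nonsing_inv_mul _ hdet, Matrix.one_mul, SO.transpose_mul]
  rw [metricDiag, metricDiag, hinv, SO.coe_inv]
  simp only [Matrix.mul_assoc]
  simp only [← Matrix.mul_assoc g.1 g.1ᵀ, SO.mul_transpose, Matrix.one_mul]
  rw [Matrix.trace_mul_comm]
  simp only [Matrix.mul_assoc, SO.mul_transpose, Matrix.mul_one]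

theorem isPiecewiseSmoothM_signedPermTranslate {p : ℕ} (g : evenSignedPerm p)
    {γ : unitInterval → M p} (h : IsPiecewiseSmoothM γ) :
    IsPiecewiseSmoothM (signedPermTranslate g ∘ γ) := by
  refine IsPiecewiseSmooth.transfer h fun a b _ _ _ h => ContDiffOn.prodMk ?_ ?_
  · exact h.fst.mul contDiffOn_const
  · exact (contDiffOn_mul_SO g.1⁻¹ g.1 h.snd).congr fun s _ =>
      signedPermTranslate_scaling g (extend γ s)

theorem speedM_signedPermTranslate {p : ℕ} (k : ℝ) (g : evenSignedPerm p)
    (γ : unitInterval → M p) : speedM k (signedPermTranslate g ∘ γ) = speedM k γ := by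
  funext t
  have h1 : deriv (fun s => (extend (signedPermTranslate g ∘ γ) s).1.1) t =
      deriv (fun s => (extend γ s).1.1) t * g.1.1 := by
    have := deriv_mul_SO 1 g.1 (fun s => (extend γ s).1.1) t
    simp only [Submonoid.coe_one, Matrix.one_mul] at this
    exact this
  have h2 : deriv (fun s => (extend (signedPermTranslate g ∘ γ) s).2.1) t =
      (g.1⁻¹).1 * deriv (fun s => (extend γ s).2.1) t * g.1.1 := by
    rw [← deriv_mul_SO g.1⁻¹ g.1]
    congr 1
    funext s
    exact signedPermTranslate_scaling g (extend γ s)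
  rw [speedM, speedM, metricSO_deriv (fun s => (extend γ s).1) t,
    metricSO_deriv (fun s => (extend (signedPermTranslate g ∘ γ) s).1) t, h1, h2,
    SO.norm_mul_right]
  congr 2
  exact metricDiag_conj g.1 (signedPermTranslate_scaling g (extend γ t)) _

theorem isFMinimalGeodesic_signedPermTranslate {p : ℕ} {k : ℝ} {X Y : SymPos p}
    (g : evenSignedPerm p) {γ : unitInterval → M p} (h : IsFMinimalGeodesic k X Y γ) :
    IsFMinimalGeodesic k X Y (signedPermTranslate g ∘ γ) where
  piecewiseSmooth := isPiecewiseSmoothM_signedPermTranslate g h.piecewiseSmooth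
  source_mem := (F_signedPermTranslate g (γ 0)).trans h.source_mem
  target_mem := (F_signedPermTranslate g (γ 1)).trans h.target_mem
  length_eq := by rw [lengthM, speedM_signedPermTranslate]; exact h.length_eq

/-- Every point of the fiber can be moved into `[(U, D)]` by an even signed permutation. -/
theorem exists_signedPermTranslate_mem_fiberComponent {p : ℕ} (hp : 0 < p) {X : SymPos p}
    {U : SO p} {D : DiagPos p} (h : (U, D) ∈ fiber X) {q : M p} (hq : q ∈ fiber X) :
    ∃ g, signedPermTranslate g q ∈ fiberComponent U D := by
  obtain ⟨g, R, hR, hgR, hg⟩ := exists_mul_eq_of_mem_fiber hp h hq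
  refine ⟨g, R, hR, Prod.ext hgR ?_⟩
  change permAct (evenSignedPerm.perm g⁻¹) q.2 = D
  rw [show q.2 = _ from hg, ← permAct_perm_mul_apply, inv_mul_cancel]
  exact permAct_perm_of_mem_stab (one_mem _)

end ScalingRotation

theorem mainTheorem10 (p : ℕ) (hp : 1 < p) (k : ℝ) (hk : 0 < k)
    (X Y : ScalingRotation.SymPos p)
    (U V : ScalingRotation.SO p) (D Λ : ScalingRotation.DiagPos p)
    (hUD : (U, D) ∈ ScalingRotation.fiber X) (hVΛ : (V, Λ) ∈ ScalingRotation.fiber Y)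
    (Z : Set (ScalingRotation.evenSignedPerm p))
    (hZ : ScalingRotation.IsDoubleCosetReps
      (ScalingRotation.Gamma0 D) (ScalingRotation.Gamma0 Λ) Z) :
    -- for every `g`, the inner minimum is attained
    (∀ g : ScalingRotation.evenSignedPerm p,
      IsLeast (ScalingRotation.rotationDistances g (U, D) (V, Λ))
        (ScalingRotation.minRotationDist g (U, D) (V, Λ))) ∧
    -- the distance formula, with an attained minimum over `Z`
    IsLeast
      {m : ℝ | ∃ g ∈ Z,
        m = k * ScalingRotation.minRotationDist g (U, D) (V, Λ) ^ 2 +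
          ScalingRotation.logRatioNorm D
            (ScalingRotation.permAct (ScalingRotation.evenSignedPerm.perm g) Λ) ^ 2}
      (ScalingRotation.distSR k X Y ^ 2) ∧
    -- every MSSR curve corresponds to a minimal pair with first element in `[(U, D)]`
    (∀ χ, ScalingRotation.IsMSSRCurve k X Y χ →
      ∃ q₀ ∈ ScalingRotation.fiberComponent U D, ∃ q₁,
        ScalingRotation.IsMinimalPair k X Y q₀ q₁ ∧
        ScalingRotation.CorrespondsTo k X Y χ q₀ q₁) ∧
    -- the same for minimal geodesics parametrized proportionally to arc length
    (∀ γ, ScalingRotation.IsFMinimalGeodesic k X Y γ → ScalingRotation.HasConstantSpeed k γ →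
      ∃ γ', ScalingRotation.IsFMinimalGeodesic k X Y γ' ∧
        ScalingRotation.HasConstantSpeed k γ' ∧
        γ' 0 ∈ ScalingRotation.fiberComponent U D ∧
        ScalingRotation.F ∘ γ' = ScalingRotation.F ∘ γ) := by
  open ScalingRotation in
  have hp0 : 0 < p := by omega
  refine ⟨fun g => isLeast_minRotationDist g _ _, ?_, ?_, ?_⟩
  · obtain ⟨g, hg⟩ := Finite.exists_min (signedPermCost k (U, D) (V, Λ))
    have hsq : ∀ g', distSR k X Y ^ 2 ≤ signedPermCost k (U, D) (V, Λ) g' := fun g' => by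
      rw [distSR_sq_eq hp0 hk hUD hVΛ hg]
      exact hg g'
    constructor
    · obtain ⟨z, ⟨hz, hzg⟩, -⟩ := hZ (DoubleCoset.mk (Gamma0 D) (Gamma0 Λ) g)
      obtain ⟨a, ha, b, hb, rfl⟩ := (DoubleCoset.eq (Gamma0 D) (Gamma0 Λ) g z).1 hzg.symm
      refine ⟨_, hz, le_antisymm (hsq _) ?_⟩
      rw [distSR_sq_eq hp0 hk hUD hVΛ hg]
      exact signedPermCost_mul_mul_le hk (U, D) (V, Λ) ha hb g
    · rintro m ⟨z, -, rfl⟩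
      exact hsq z
  · rintro χ ⟨γ, hγ, rfl⟩
    obtain ⟨g, hg⟩ := exists_signedPermTranslate_mem_fiberComponent hp0 hUD hγ.source_mem
    have hγ' := isFMinimalGeodesic_signedPermTranslate g hγ
    exact ⟨_, hg, _, ⟨_, hγ', rfl, rfl⟩, _, hγ',
      funext fun t => (F_signedPermTranslate g (γ t)).symm, rfl, rfl⟩
  · intro γ hγ hs
    obtain ⟨g, hg⟩ := exists_signedPermTranslate_mem_fiberComponent hp0 hUD hγ.source_mem
    refine ⟨signedPermTranslate g ∘ γ, isFMinimalGeodesic_signedPermTranslate g hγ, ?_, hg,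
      funext fun t => F_signedPermTranslate g (γ t)⟩
    simpa only [HasConstantSpeed, lengthM, speedM_signedPermTranslate] using hs
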